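/- **Conventions.** For symmetric bilinear forms let $(h\circ k)_{abcd}=h_{ac}k_{bd}-h_{ad}k_{bc}+h_{bd}k_{ac}-h_{bc}k_{ad}$. Let $g=\langle\cdot,\cdot\rangle$ be a smooth symmetric, possibly degenerate, bilinear form field on an $n$-dimensional manifold $M$, and let $\flat(T_pM)=\{\langle v,\cdot\rangle : v\in T_pM\}$, with inner product $g_\bullet(v^\flat,w^\flat)=\langle v,w\rangle$. The Koszul form is $$\mathcal K(X,Y,Z)=\tfrac12\{X\langle Y,Z\rangle+Y\langle Z,X\rangle-Z\langle X,Y\rangle-\langle X,[Y,Z]\rangle+\langle Y,[Z,X]\rangle+\langle Z,[X,Y]\rangle\}.$$ Suppose that $g$ is non-degenerate on a dense subset of $M$. Then $(M,g)$ is *semi-regular* if $\mathcal K(X,Y,\_)\in\flat(T_pM)$ at every point $p$, and if the contraction $g_\bullet(\mathcal K(X,Y,\_),\mathcal K(Z,T,\_))$, taken at the points where $g$ is non-degenerate, extends smoothly, for all local vector fields $X,Y,Z,T$. Where $g$ is non-degenerate put $\Gamma_{abc}=\mathcal K(\partial_a,\partial_b,\partial_c)$, $R_{abcd}=\partial_a\Gamma_{bcd}-\partial_b\Gamma_{acd}+g^{st}(\Gamma_{acs}\Gamma_{bdt}-\Gamma_{bcs}\Gamma_{adt})$,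 $R_{ab}=g^{st}R_{asbt}$, $R=g^{st}R_{st}$, $S_{ab}=R_{ab}-\frac1nRg_{ab}$, $G_{ab}=R_{ab}-\frac12Rg_{ab}$, $S_{abcd}=\frac{1}{2n(n-1)}R\,(g\circ g)_{abcd}$ and $E_{abcd}=\frac1{n-2}(S\circ g)_{abcd}$. The manifold is *quasi-regular* if it is semi-regular and $S_{abcd}$ and $E_{abcd}$ extend from the points where $g$ is non-degenerate to smooth tensor fields on $M$. It is a *quasi-regular spacetime* if moreover $n=4$ and at every point $g$ has at most $3$ positive and at most $1$ negative squares. **Corollary.** Let $I\subseteq\mathbb R$ be an interval with non-empty interior (its end points may or may not belong to it), $(\Sigma,d\Sigma^2)$ a three-dimensional smooth Riemannian manifold, $c>0$, and $a:I\to\mathbb R$ a smooth function, allowed to vanish but non-zero on a dense subset of $I$. Then the FLRW spacetime $I\times_a\Sigma$, i.e. $I\times\Sigma$ with the metric $g=-c^2dt^2+a(t)^2d\Sigma^2$, is a quasi-regular spacetime. Consequently: 1. the expanded Einstein tensor $(G\circ g)_{abcd}$, defined where $a\neq0$, extends to a smooth tensor field on $I\times\Sigma$; 2. for all real $\Lambda$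 and $\kappa\ne0$, if $T_{ab}$ satisfies the Einstein equation $G_{ab}+\Lambda g_{ab}=\kappa T_{ab}$ where $a\neq0$, then the expanded stress-energy tensor $(T\circ g)_{abcd}$, defined where $a\ne0$, extends to a smooth tensor field on $I\times\Sigma$. -/

import Mathlib

open scoped Manifold ContDiff

noncomputable section

namespace SingularGR

/-! ### Singular metrics in a coordinate patch

`V` is the coordinate patch, a subset of the model space `E`, and `g` the matrix of metric
components, as a field of bilinear forms on `E`. The form `g x` may be degenerate.
All derivatives are taken within `V`, so that a patch with boundary is allowed. -/

section Patch

variable {E : Type*} [NormedAddCommGroup E] [NormedSpace ℝ E]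

/-- The inner product `g_•` on the image `♭(E) = {B v | v}` of a symmetric bilinear form `B`:
`g_•(v♭, w♭) = B v w`. It is the covariant contraction of the two `1`-forms `α` and `β`
(and `0` by convention if one of them is not in the image of `♭`). If `B` is non-degenerate, it is
`g^{st} α_s β_t`. -/
def contract (B : LinearMap.BilinForm ℝ E) (α β : E → ℝ) : ℝ :=
  open Classical in
  if h : (∃ v, ∀ z, B v z = α z) ∧ (∃ w, ∀ z, B w z = β z) then
    B h.1.choose h.2.choose else 0

/-- `contract` does not depend on the chosen representatives. -/
theorem contract_eq (B : LinearMap.BilinForm ℝ E) (hB : ∀ v w, B v w = B w v)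
    (α β : E → ℝ) (v w : E) (hv : ∀ z, B v z = α z) (hw : ∀ z, B w z = β z) :
    contract B α β = B v w := by
  have h : (∃ v, ∀ z, B v z = α z) ∧ (∃ w, ∀ z, B w z = β z) := ⟨⟨v, hv⟩, ⟨w, hw⟩⟩
  rw [contract, dif_pos h, h.1.choose_spec, ← hv, hB v, h.2.choose_spec, ← hw, hB w]

/-- The Koszul form `𝒦(X, Y, Z)` at `x`:
`½ {X⟨Y,Z⟩ + Y⟨Z,X⟩ - Z⟨X,Y⟩ - ⟨X,[Y,Z]⟩ + ⟨Y,[Z,X]⟩ + ⟨Z,[X,Y]⟩}`. -/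
def koszul (V : Set E) (g : E → LinearMap.BilinForm ℝ E) (X Y Z : E → E) (x : E) : ℝ :=
  (1 / 2) *
    (fderivWithin ℝ (fun q => g q (Y q) (Z q)) V x (X x)
      + fderivWithin ℝ (fun q => g q (Z q) (X q)) V x (Y x)
      - fderivWithin ℝ (fun q => g q (X q) (Y q)) V x (Z x)
      - g x (X x) (VectorField.lieBracketWithin ℝ Y Z V x)
      + g x (Y x) (VectorField.lieBracketWithin ℝ Z X V x)
      + g x (Z x) (VectorField.lieBracketWithin ℝ X Y V x))

/-- The `1`-form `𝒦(X, Y, _)` at `x`. The Koszul form is tensorial in its last slot, so a vector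
may be inserted there by means of a constant vector field. -/
def koszulForm (V : Set E) (g : E → LinearMap.BilinForm ℝ E) (X Y : E → E) (x : E) : E → ℝ :=
  fun z => koszul V g X Y (fun _ => z) x

/-- Christoffel's symbols of the first kind, `𝒦(∂_u, ∂_v, ∂_w)` for coordinate vector fields. -/
def christoffel (V : Set E) (g : E → LinearMap.BilinForm ℝ E) (u v w : E) (x : E) : ℝ :=
  koszul V g (fun _ => u) (fun _ => v) (fun _ => w) x

/-- The Riemann curvature
`R_{abcd} = ∂_a Γ_{bcd} - ∂_b Γ_{acd} + Γ_{ac•} Γ_{bd•} - Γ_{bc•} Γ_{ad•}`. -/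
def riemann (V : Set E) (g : E → LinearMap.BilinForm ℝ E) (x a b c d : E) : ℝ :=
  fderivWithin ℝ (christoffel V g b c d) V x a
    - fderivWithin ℝ (christoffel V g a c d) V x b
    + contract (g x) (fun z => christoffel V g a c z x) (fun z => christoffel V g b d z x)
    - contract (g x) (fun z => christoffel V g b c z x) (fun z => christoffel V g a d z x)

variable [FiniteDimensional ℝ E]

/-- The contraction `g^{st} A_{st}`, where `g^{st}` is the inverse of the matrix of `B` in a basis
of `E` (the result does not depend on the basis). Only meaningful where `B` is non-degenerate. -/
def metricTrace (B : LinearMap.BilinForm ℝ E) (A : E → E → ℝ) : ℝ :=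
  ∑ s, ∑ t, (Matrix.of fun i j =>
      B (Module.finBasis ℝ E i) (Module.finBasis ℝ E j))⁻¹ s t
    * A (Module.finBasis ℝ E s) (Module.finBasis ℝ E t)

/-- The Ricci curvature `R_{ab} = g^{st} R_{asbt}`. -/
def ricci (V : Set E) (g : E → LinearMap.BilinForm ℝ E) (x a b : E) : ℝ :=
  metricTrace (g x) fun s t => riemann V g x a s b t

/-- The scalar curvature `R = g^{st} R_{st}`. -/
def scalarCurv (V : Set E) (g : E → LinearMap.BilinForm ℝ E) (x : E) : ℝ :=
  metricTrace (g x) (ricci V g x)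

/-- The traceless part `S_{ab} = R_{ab} - (1/n) R g_{ab}` of the Ricci curvature. -/
def tracelessRicci (V : Set E) (g : E → LinearMap.BilinForm ℝ E) (x a b : E) : ℝ :=
  ricci V g x a b - 1 / (Module.finrank ℝ E : ℝ) * scalarCurv V g x * g x a b

/-- The Einstein tensor `G_{ab} = R_{ab} - ½ R g_{ab}`. -/
def einstein (V : Set E) (g : E → LinearMap.BilinForm ℝ E) (x a b : E) : ℝ :=
  ricci V g x a b - 1 / 2 * scalarCurv V g x * g x a b

/-- The Kulkarni-Nomizu product
`(h ∘ k)_{abcd} = h_{ac} k_{bd} - h_{ad} k_{bc} + h_{bd} k_{ac} - h_{bc} k_{ad}`. -/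
def kulkarniNomizu (h k : E → E → ℝ) (a b c d : E) : ℝ :=
  h a c * k b d - h a d * k b c + h b d * k a c - h b c * k a d

/-- The scalar part `S_{abcd} = 1 / (2 n (n - 1)) R (g ∘ g)_{abcd}` of the Riemann curvature. -/
def scalarPart (V : Set E) (g : E → LinearMap.BilinForm ℝ E) (x a b c d : E) : ℝ :=
  1 / (2 * (Module.finrank ℝ E : ℝ) * ((Module.finrank ℝ E : ℝ) - 1)) * scalarCurv V g x
    * kulkarniNomizu (fun u v => g x u v) (fun u v => g x u v) a b c d

/-- The semi-traceless part `E_{abcd} = 1 / (n - 2) (S ∘ g)_{abcd}` of the Riemann curvature. -/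
def semiTracelessPart (V : Set E) (g : E → LinearMap.BilinForm ℝ E) (x a b c d : E) : ℝ :=
  1 / ((Module.finrank ℝ E : ℝ) - 2)
    * kulkarniNomizu (tracelessRicci V g x) (fun u v => g x u v) a b c d

/-- The expanded Einstein tensor `G_{abcd} = (G ∘ g)_{abcd}`. -/
def expandedEinstein (V : Set E) (g : E → LinearMap.BilinForm ℝ E) (x a b c d : E) : ℝ :=
  kulkarniNomizu (einstein V g x) (fun u v => g x u v) a b c d

/-- The tensor field `T`, considered only at the points of `V` where `g` is non-degenerate, extends
to a smooth tensor field on all of `V`. -/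
def ExtendsSmoothlyOn (V : Set E) (g : E → LinearMap.BilinForm ℝ E)
    (T : E → E → E → E → E → ℝ) : Prop :=
  ∃ F : E → E [×4]→L[ℝ] ℝ, ContDiffOn ℝ ∞ F V ∧
    ∀ x ∈ V, (g x).Nondegenerate → ∀ a b c d, F x ![a, b, c, d] = T x a b c d

end Patch

/-! ### Singular metrics on a manifold

The manifold carrying the metric is a subset `D` of a smooth manifold `N` without boundary: `N`
itself, an open subset, or a domain with boundary. -/

section Manifold

variable {E H : Type*} [NormedAddCommGroup E] [NormedSpace ℝ E] [FiniteDimensional ℝ E]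
  [TopologicalSpace H]

/-- A field of bilinear forms on the tangent spaces of `N`. -/
abbrev BilinField (I : ModelWithCorners ℝ E H) (N : Type*) [TopologicalSpace N]
    [ChartedSpace H N] :=
  ∀ p : N, LinearMap.BilinForm ℝ (TangentSpace I p)

variable (I : ModelWithCorners ℝ E H) {N : Type*} [TopologicalSpace N] [ChartedSpace H N]

/-- The part of the subset `D` that is covered by the chart `φ`, in coordinates. -/
def patch (φ : OpenPartialHomeomorph N H) (D : Set N) : Set E :=
  (φ.extend I).target ∩ (φ.extend I).symm ⁻¹' D

/-- The components of the field `g` in the chart `φ`. -/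
def inChart (φ : OpenPartialHomeomorph N H) (g : BilinField I N) (x : E) :
    LinearMap.BilinForm ℝ E :=
  let d : E →ₗ[ℝ] TangentSpace I ((φ.extend I).symm x) :=
    (mfderiv 𝓘(ℝ, E) I (φ.extend I).symm x).toLinearMap
  (g ((φ.extend I).symm x)).compl₁₂ d d

/-- A field of four-linear forms, given by its components in the charts of the atlas (it may depend
on the chart through the patch and the components of the metric) and considered at the points of
`D` where `g` is non-degenerate, extends smoothly to `D`. Where the points with non-degenerate `g`
are dense, the extensions in the charts are unique, so those of a tensor field fit together to one
tensor field on `D`. -/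
def TensorExtendsSmoothly (D : Set N) (g : BilinField I N)
    (T : OpenPartialHomeomorph N H → E → E → E → E → E → ℝ) : Prop :=
  ∀ φ ∈ atlas H N, ExtendsSmoothlyOn (patch I φ D) (inChart I φ g) (T φ)

/-- `(D, g)` is a semi-regular manifold whose metric is non-degenerate on a dense subset. -/
structure IsSemiRegular (D : Set N) (g : BilinField I N) : Prop where
  symm : ∀ p ∈ D, ∀ u v, g p u v = g p v u
  smooth : ∀ φ ∈ atlas H N, ∀ u v : E,
    ContDiffOn ℝ ∞ (fun x => inChart I φ g x u v) (patch I φ D)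
  dense : D ⊆ closure {p ∈ D | (g p).Nondegenerate}
  /-- `𝒦(X, Y, _) ∈ ♭(T_p M)` at every point `p`, for all local vector fields `X`, `Y`. -/
  koszul_mem : ∀ φ ∈ atlas H N, ∀ O : Set E, IsOpen O → ∀ X Y : E → E,
    ContDiffOn ℝ ∞ X (patch I φ D ∩ O) → ContDiffOn ℝ ∞ Y (patch I φ D ∩ O) →
    ∀ x ∈ patch I φ D ∩ O, ∃ v : E, ∀ z : E,
      inChart I φ g x v z = koszulForm (patch I φ D ∩ O) (inChart I φ g) X Y x z
  /-- The contraction `𝒦(X, Y, •) 𝒦(Z, T, •)` of the Koszul forms of local vector fields, on the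
  dense set where `g` is non-degenerate, extends smoothly. -/
  koszul_contract : ∀ φ ∈ atlas H N, ∀ O : Set E, IsOpen O → ∀ X Y Z T : E → E,
    ContDiffOn ℝ ∞ X (patch I φ D ∩ O) → ContDiffOn ℝ ∞ Y (patch I φ D ∩ O) →
    ContDiffOn ℝ ∞ Z (patch I φ D ∩ O) → ContDiffOn ℝ ∞ T (patch I φ D ∩ O) →
    ∃ f : E → ℝ, ContDiffOn ℝ ∞ f (patch I φ D ∩ O) ∧
      ∀ x ∈ patch I φ D ∩ O, (inChart I φ g x).Nondegenerate →
        f x = contract (inChart I φ g x)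
          (koszulForm (patch I φ D ∩ O) (inChart I φ g) X Y x)
          (koszulForm (patch I φ D ∩ O) (inChart I φ g) Z T x)

/-- Quasi-regular manifolds. -/
structure IsQuasiRegular (D : Set N) (g : BilinField I N) : Prop
    extends IsSemiRegular I D g where
  scalarPart_extends : TensorExtendsSmoothly I D g fun φ =>
    scalarPart (patch I φ D) (inChart I φ g)
  semiTracelessPart_extends : TensorExtendsSmoothly I D g fun φ =>
    semiTracelessPart (patch I φ D) (inChart I φ g)

/-- Quasi-regular spacetimes: of dimension `4`, and at every point of signature `(r, s, t)` with
`s ≤ 3`, `t ≤ 1`, where `s` and `t` are the numbers of positive and negative squares. -/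
structure IsQuasiRegularSpacetime (D : Set N) (g : BilinField I N) : Prop
    extends IsQuasiRegular I D g where
  dim_eq : Module.finrank ℝ E = 4
  sigPos_le : ∀ p ∈ D, sigPos (LinearMap.BilinMap.toQuadraticMap (g p)) ≤ 3
  sigNeg_le : ∀ p ∈ D, sigNeg (LinearMap.BilinMap.toQuadraticMap (g p)) ≤ 1

/-- The Einstein equation `G_{ab} + Λ g_{ab} = κ T_{ab}`, at the points of `D` where `g` is
non-degenerate. -/
def EinsteinEquation (D : Set N) (g T : BilinField I N) (Λ κ : ℝ) : Prop :=
  ∀ φ ∈ atlas H N, ∀ x ∈ patch I φ D, (inChart I φ g x).Nondegenerate → ∀ u v : E,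
    einstein (patch I φ D) (inChart I φ g) x u v + Λ * inChart I φ g x u v
      = κ * inChart I φ T x u v

end Manifold

/-! ### Degenerate warped products and FLRW spacetimes -/

/-- The degenerate warped product metric `gB + f² gF` on `B × F`; `f` may vanish. -/
def warpedProduct {E H E' H' : Type*} [NormedAddCommGroup E] [NormedSpace ℝ E]
    [TopologicalSpace H] [NormedAddCommGroup E'] [NormedSpace ℝ E'] [TopologicalSpace H']
    (I : ModelWithCorners ℝ E H) (J : ModelWithCorners ℝ E' H')
    {B F : Type*} [TopologicalSpace B] [ChartedSpace H B] [TopologicalSpace F]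
    [ChartedSpace H' F] (gB : BilinField I B) (f : B → ℝ) (gF : BilinField J F) :
    BilinField (I.prod J) (B × F) := fun p =>
  let π₁ : TangentSpace (I.prod J) p →ₗ[ℝ] TangentSpace I p.1 := LinearMap.fst ℝ E E'
  let π₂ : TangentSpace (I.prod J) p →ₗ[ℝ] TangentSpace J p.2 := LinearMap.snd ℝ E E'
  (gB p.1).compl₁₂ π₁ π₁ + f p.1 ^ 2 • (gF p.2).compl₁₂ π₂ π₂

/-- The metric `-c² dt²` on the real line. -/
def timeMetric (c : ℝ) : BilinField 𝓘(ℝ, ℝ) ℝ := fun _ =>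
  (-c ^ 2) • (LinearMap.mul ℝ ℝ : LinearMap.BilinForm ℝ ℝ)

/-- The FLRW metric `-c² dt² + a(t)² dΣ²`, where `h` is the Riemannian metric `dΣ²` of the
three-dimensional manifold `S`. -/
def flrwMetric {S : Type*} [TopologicalSpace S] [ChartedSpace (EuclideanSpace ℝ (Fin 3)) S]
    [IsManifold (𝓡 3) ∞ S] (c : ℝ) (a : ℝ → ℝ)
    (h : Bundle.ContMDiffRiemannianMetric (𝓡 3) ∞ (EuclideanSpace ℝ (Fin 3))
      (fun x : S => TangentSpace (𝓡 3) x)) :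
    BilinField (𝓘(ℝ, ℝ).prod (𝓡 3)) (ℝ × S) :=
  warpedProduct 𝓘(ℝ, ℝ) (𝓡 3) (timeMetric c) a fun x => (h.inner x).toLinearMap₁₂

end SingularGR

end

/-! In each chart the metric is -c² dt² + a² h with h positive definite, and the only possible
trouble is division by a. The argument tracks powers of a and shows that none of the required
quantities divides by it. It works for a base of any positive finite dimension m; dimension 3 enters
only in the dimension count and the bound on positive squares.

Semi-regularity: 𝒦(X, Y, _) equals -τ dt + a h(A, ·) with τ and A smooth (`koszulForm_eq`, with τ
and A given by `koszulTime` and `koszulSpace`). Because of the factor a, this form is represented by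
(τ/c², A/a) where a ≠ 0 and by (τ/c², 0) where a = 0. The contraction of two such forms is -ττ'/c² +
h(A, A'), in which the powers of a cancel (`contract_eq`).

Quasi-regularity: the explicit curvature `riemann_eq` gives Ric = m (a''/a) dt² + ρ with ρ smooth
and purely spatial, and R = s/a² with s smooth (`ricci_eq`, `scalarCurv_eq`). The Kulkarni-Nomizu
product removes these poles because dt² ∘ dt² = 0. Hence dt² pairs only with a² h, which gives
(a''/a) dt² ∘ g = a a'' dt² ∘ h. Likewise g ∘ g = a² h ∘ (-2c² dt² + a² h), and its factor a²
absorbs the pole of R.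

All tensors in the statement are constant-coefficient combinations of Ric ∘ g, R g ∘ g and g ∘ g
(`extendsSmoothlyOn_of_combination`), the stress-energy tensor by way of the Einstein equation. -/

noncomputable section

namespace SingularGR

set_option maxSynthPendingDepth 3
set_option linter.unusedSectionVars false

/-! ### Metric traces, Kulkarni-Nomizu products and smooth extension -/

section Algebra

variable {E : Type*} [NormedAddCommGroup E] [NormedSpace ℝ E] [FiniteDimensional ℝ E]

/-- The metric trace computed in any basis `b`, by means of a family `w` that is dual to `b` with
respect to the form `B`. -/
theorem metricTrace_eq_sum {ι : Type*} [Fintype ι] [DecidableEq ι] (B A : LinearMap.BilinForm ℝ E)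
    (b : Module.Basis ι ℝ E) (w : ι → E) (hw : ∀ j i, B (b j) (w i) = if j = i then 1 else 0) :
    metricTrace B (fun s t => A s t) = ∑ i, A (w i) (b i) := by
  -- Duality turns the numbers B(v, wᵢ) into the coordinates of v in b; hence Σᵢ wᵢ ⊗ bᵢ is the
  -- inverse metric, which is then written out in the basis f.
  have hexp : ∀ v, ∑ i, B v (w i) • b i = v := by
    intro v
    have : (∑ i, (B.flip (w i)).smulRight (b i)) = (LinearMap.id : E →ₗ[ℝ] E) := by
      refine b.ext fun j => ?_
      simp [hw]
    simpa using congrArg (fun f : E →ₗ[ℝ] E => f v) this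
  set f := Module.finBasis ℝ E
  have hinv : (Matrix.of fun i j => B (f i) (f j))⁻¹ =
      Matrix.of fun s t => ∑ i, f.repr (w i) s * f.repr (b i) t := by
    refine Matrix.inv_eq_right_inv ?_
    ext s k
    have h1 : ∀ i, ∑ t, B (f s) (f t) * f.repr (w i) t = B (f s) (w i) := by
      intro i
      have := congrArg (B (f s)) (f.sum_repr (w i))
      simp only [map_sum, map_smul, smul_eq_mul] at this
      simpa only [mul_comm] using this
    have h2 : f.repr (f s) k = ∑ i, B (f s) (w i) * f.repr (b i) k := by
      conv_lhs => rw [← hexp (f s)]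
      simp
    have h3 : (1 : Matrix _ _ ℝ) s k = f.repr (f s) k := by
      rw [f.repr_self, Finsupp.single_apply, Matrix.one_apply]
    rw [h3, h2, Matrix.mul_apply]
    simp only [Matrix.of_apply, ← h1, Finset.mul_sum, Finset.sum_mul]
    rw [Finset.sum_comm]
    simp only [mul_assoc]
  unfold metricTrace
  rw [hinv]
  simp only [Matrix.of_apply, Finset.sum_mul]
  have h4 : ∀ i, A (w i) (b i) =
      ∑ s, ∑ t, f.repr (w i) s * f.repr (b i) t * A (f s) (f t) := by
    intro i
    have h5 : ∀ v, A v (b i) = ∑ t, f.repr (b i) t * A v (f t) := fun v => by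
      have := congrArg (A v) (f.sum_repr (b i))
      simp only [map_sum, map_smul, smul_eq_mul] at this
      exact this.symm
    have := congrArg (fun v => A v (b i)) (f.sum_repr (w i))
    simp only [map_sum, map_smul, LinearMap.sum_apply, LinearMap.smul_apply, smul_eq_mul] at this
    rw [← this]
    simp only [h5, Finset.mul_sum, mul_assoc]
  simp only [h4]
  rw [Finset.sum_congr rfl fun s _ => Finset.sum_comm, Finset.sum_comm]

/-- Currying one slot at a time reduces this to linear maps on a finite-dimensional space, where
evaluation at every vector detects smoothness. -/
theorem contDiffOn_continuousMultilinear_apply {W : Type*} [NormedAddCommGroup W] [NormedSpace ℝ W]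
    {V : Set W} {k : ℕ∞ω} {n : ℕ} (F : W → E [×n]→L[ℝ] ℝ)
    (hF : ∀ m, ContDiffOn ℝ k (fun x => F x m) V) : ContDiffOn ℝ k F V := by
  induction n with
  | zero =>
    have := (continuousMultilinearCurryFin0 ℝ E ℝ).symm.contDiff.comp_contDiffOn (hF 0)
    refine this.congr fun x _ => ?_
    ext m
    simp [Subsingleton.elim m 0]
  | succ n ih =>
    have h1 : ContDiffOn ℝ k
        (fun x => continuousMultilinearCurryLeftEquiv ℝ (fun _ : Fin (n + 1) => E) ℝ (F x)) V := by
      refine contDiffOn_clm_apply.2 fun e => ih _ fun m => ?_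
      simpa using! hF (Fin.cons e m)
    have := (continuousMultilinearCurryLeftEquiv ℝ (fun _ : Fin (n + 1) => E)
      ℝ).symm.contDiff.comp_contDiffOn h1
    refine this.congr fun x _ => ?_
    simp

/-- The Kulkarni-Nomizu product of two bilinear forms as a four-linear form. -/
def kulkarniNomizuForm (h k : E →L[ℝ] E →L[ℝ] ℝ) : E [×4]→L[ℝ] ℝ where
  toFun m := h (m 0) (m 2) * k (m 1) (m 3) - h (m 0) (m 3) * k (m 1) (m 2)
    + h (m 1) (m 3) * k (m 0) (m 2) - h (m 1) (m 2) * k (m 0) (m 3)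
  map_update_add' := by
    intro inst m i x y
    -- The multilinearity fields quantify over all decidability instances; with the standard one
    -- `simp` can evaluate the updates.
    obtain rfl : inst = instDecidableEqFin 4 := Subsingleton.elim _ _
    obtain rfl | rfl | rfl | rfl : i = 0 ∨ i = 1 ∨ i = 2 ∨ i = 3 := by lia
    all_goals
      simp [Function.update]
      ring
  map_update_smul' := by
    intro inst m i r x
    obtain rfl : inst = instDecidableEqFin 4 := Subsingleton.elim _ _
    obtain rfl | rfl | rfl | rfl : i = 0 ∨ i = 1 ∨ i = 2 ∨ i = 3 := by lia
    all_goals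
      simp [Function.update]
      ring
  cont := by fun_prop

omit [FiniteDimensional ℝ E] in
theorem kulkarniNomizuForm_apply (h k : E →L[ℝ] E →L[ℝ] ℝ) (a b c d : E) :
    kulkarniNomizuForm h k ![a, b, c, d] =
      kulkarniNomizu (fun u v => h u v) (fun u v => k u v) a b c d := rfl

variable {V : Set E} {g : E → LinearMap.BilinForm ℝ E}

theorem extendsSmoothlyOn_kulkarniNomizu {h k : E → E →L[ℝ] E →L[ℝ] ℝ}
    (hh : ContDiffOn ℝ ∞ h V) (hk : ContDiffOn ℝ ∞ k V) :
    ExtendsSmoothlyOn V g fun x => kulkarniNomizu (fun u v => h x u v) (fun u v => k x u v) := by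
  refine ⟨fun x => kulkarniNomizuForm (h x) (k x),
    contDiffOn_continuousMultilinear_apply _ fun m => ?_,
    fun x _ _ a b c d => kulkarniNomizuForm_apply _ _ _ _ _ _⟩
  have e : ∀ (l : E → E →L[ℝ] E →L[ℝ] ℝ), ContDiffOn ℝ ∞ l V → ∀ u v,
      ContDiffOn ℝ ∞ (fun x => l x u v) V := fun l hl u v =>
    (hl.clm_apply contDiffOn_const).clm_apply contDiffOn_const
  exact ((((e h hh _ _).mul (e k hk _ _)).sub ((e h hh _ _).mul (e k hk _ _))).add
    ((e h hh _ _).mul (e k hk _ _))).sub ((e h hh _ _).mul (e k hk _ _))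

omit [FiniteDimensional ℝ E] in
theorem ExtendsSmoothlyOn.congr {T T' : E → E → E → E → E → ℝ} (hT : ExtendsSmoothlyOn V g T)
    (h : ∀ x ∈ V, (g x).Nondegenerate → ∀ a b c d, T' x a b c d = T x a b c d) :
    ExtendsSmoothlyOn V g T' := by
  obtain ⟨F, hF, hFT⟩ := hT
  exact ⟨F, hF, fun x hx hg a b c d => (hFT x hx hg a b c d).trans (h x hx hg a b c d).symm⟩

omit [FiniteDimensional ℝ E] in
theorem ExtendsSmoothlyOn.linearCombination {T T' : E → E → E → E → E → ℝ}
    (hT : ExtendsSmoothlyOn V g T) (hT' : ExtendsSmoothlyOn V g T') (r s : ℝ) :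
    ExtendsSmoothlyOn V g fun x a b c d => r * T x a b c d + s * T' x a b c d := by
  obtain ⟨F, hF, hFT⟩ := hT
  obtain ⟨F', hF', hFT'⟩ := hT'
  refine ⟨fun x => r • F x + s • F' x, (hF.const_smul r).add (hF'.const_smul s),
    fun x hx hg a b c d => ?_⟩
  simp [← hFT x hx hg, ← hFT' x hx hg]

end Algebra

/-! ### The Koszul form in coordinates -/

section Koszul

variable {E : Type*} [NormedAddCommGroup E] [NormedSpace ℝ E]

/-- The Koszul form in terms of the derivative of the metric components. -/
theorem koszulForm_eq_fderivWithin {g : E → LinearMap.BilinForm ℝ E} {G : E → E →L[ℝ] E →L[ℝ] ℝ}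
    {V : Set E} {x : E} (hg : ∀ q ∈ V, ∀ u v, g q u v = G q u v) (hx : x ∈ V)
    (hV : UniqueDiffWithinAt ℝ V x) {G' : E →L[ℝ] E →L[ℝ] E →L[ℝ] ℝ}
    (hG : HasFDerivWithinAt G G' V x) {X Y : E → E} {X' Y' : E →L[ℝ] E}
    (hX : HasFDerivWithinAt X X' V x) (hY : HasFDerivWithinAt Y Y' V x)
    (hs : ∀ u v, G x u v = G x v u) (z : E) :
    koszulForm V g X Y x z =
      1 / 2 * (G' (X x) (Y x) z + G' (Y x) z (X x) - G' z (X x) (Y x)) + G x (Y' (X x)) z := by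
  have key : ∀ {A B : E → E} {A' B' : E →L[ℝ] E}, HasFDerivWithinAt A A' V x →
      HasFDerivWithinAt B B' V x → ∀ e, fderivWithin ℝ (fun q => g q (A q) (B q)) V x e =
        G' e (A x) (B x) + G x (A' e) (B x) + G x (A x) (B' e) := by
    intro A B A' B' hA hB e
    have h1 : HasFDerivWithinAt (fun q => g q (A q) (B q)) _ V x :=
      ((hG.clm_apply hA).clm_apply hB).congr (fun q hq => hg q hq _ _) (hg x hx _ _)
    rw [h1.fderivWithin hV]
    simp
    ring
  have hc : HasFDerivWithinAt (fun _ : E => z) (0 : E →L[ℝ] E) V x :=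
    hasFDerivWithinAt_const z x V
  simp only [koszulForm, koszul, VectorField.lieBracketWithin, key hX hY, key hY hc, key hc hX,
    hX.fderivWithin hV, hY.fderivWithin hV, hc.fderivWithin hV, hg x hx]
  simp only [map_sub, zero_apply, map_zero]
  -- By symmetry the derivatives of X cancel against the bracket terms, as does Y'(z); only two
  -- copies of G(Y'(X), z) survive.
  rw [hs (X' z)]
  rw [hs (Y' (X x)) z, hs (Y x)]
  ring

end Koszul

/-! ### Christoffel symbols and curvature of the base metric -/

section Base

variable {E' : Type*} [NormedAddCommGroup E'] [NormedSpace ℝ E']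

/-- Christoffel's symbols of the first kind as a `1`-form, where `D` is the derivative of the
metric. -/
def christoffelForm (D : E' →L[ℝ] E' →L[ℝ] E' →L[ℝ] ℝ) (u v : E') : E' →L[ℝ] ℝ :=
  (1 / 2 : ℝ) • (D u v + (D v).flip u - (D.flip u).flip v)

@[simp] theorem christoffelForm_apply (D : E' →L[ℝ] E' →L[ℝ] E' →L[ℝ] ℝ) (u v w : E') :
    christoffelForm D u v w = 1 / 2 * (D u v w + D v w u - D w u v) := by
  simp [christoffelForm]

/-- Christoffel's symbols of the second kind. -/
def christoffelVec (B : E' →L[ℝ] E' →L[ℝ] ℝ) (D : E' →L[ℝ] E' →L[ℝ] E' →L[ℝ] ℝ) (u v : E') : E' :=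
  B.inverse (christoffelForm D u v)

variable (B : E' →L[ℝ] E' →L[ℝ] ℝ) (D : E' →L[ℝ] E' →L[ℝ] E' →L[ℝ] ℝ)

theorem christoffelForm_add_left (u u' v : E') :
    christoffelForm D (u + u') v = christoffelForm D u v + christoffelForm D u' v := by
  ext w; simp; ring

theorem christoffelForm_add_right (u v v' : E') :
    christoffelForm D u (v + v') = christoffelForm D u v + christoffelForm D u v' := by
  ext w; simp; ring

theorem christoffelForm_smul_left (r : ℝ) (u v : E') :
    christoffelForm D (r • u) v = r • christoffelForm D u v := by
  ext w; simp; ring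

theorem christoffelForm_smul_right (r : ℝ) (u v : E') :
    christoffelForm D u (r • v) = r • christoffelForm D u v := by
  ext w; simp; ring

theorem christoffelVec_add_left (u u' v : E') :
    christoffelVec B D (u + u') v = christoffelVec B D u v + christoffelVec B D u' v := by
  simp [christoffelVec, christoffelForm_add_left]

theorem christoffelVec_add_right (u v v' : E') :
    christoffelVec B D u (v + v') = christoffelVec B D u v + christoffelVec B D u v' := by
  simp [christoffelVec, christoffelForm_add_right]

theorem christoffelVec_smul_left (r : ℝ) (u v : E') :
    christoffelVec B D (r • u) v = r • christoffelVec B D u v := by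
  simp [christoffelVec, christoffelForm_smul_left]

theorem christoffelVec_smul_right (r : ℝ) (u v : E') :
    christoffelVec B D u (r • v) = r • christoffelVec B D u v := by
  simp [christoffelVec, christoffelForm_smul_right]

/-- Positivity makes v ↦ B(v, ·) injective, and the dual has the same dimension. This gives raised
indices on the base, which then depend smoothly on the point because inversion is smooth at
invertible maps. -/
theorem isInvertible_of_pos [FiniteDimensional ℝ E'] (hB : ∀ v, v ≠ 0 → 0 < B v v) :
    B.IsInvertible := by
  have hinj : Function.Injective B := by
    refine (injective_iff_map_eq_zero B).2 fun v hv => ?_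
    by_contra h0
    have := hB v h0
    simp [hv] at this
  let l : (E' →L[ℝ] ℝ) ≃ₗ[ℝ] Module.Dual ℝ E' := LinearMap.toContinuousLinearMap.symm
  have hfr : Module.finrank ℝ E' = Module.finrank ℝ (E' →L[ℝ] ℝ) := by
    rw [l.finrank_eq, Subspace.dual_finrank_eq]
  have : FiniteDimensional ℝ (E' →L[ℝ] ℝ) := l.symm.finiteDimensional
  let e : E' ≃L[ℝ] (E' →L[ℝ] ℝ) :=
    (LinearEquiv.ofInjectiveOfFinrankEq B.toLinearMap hinj hfr).toContinuousLinearEquiv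
  exact ⟨e, by ext; rfl⟩

/-- The Riemann curvature of a metric with value `B`, first derivative `D` and second derivative
`D₂`. -/
def curvatureForm (D₂ : E' →L[ℝ] E' →L[ℝ] E' →L[ℝ] E' →L[ℝ] ℝ) (p q r s : E') : ℝ :=
  christoffelForm (D₂ p) q r s - christoffelForm (D₂ q) p r s
    + B (christoffelVec B D p r) (christoffelVec B D q s)
    - B (christoffelVec B D q r) (christoffelVec B D p s)

/-- The form `p dt² + k` on `ℝ × E'`. -/
def prodForm (p : ℝ) (k : E' →L[ℝ] E' →L[ℝ] ℝ) : (ℝ × E') →L[ℝ] (ℝ × E') →L[ℝ] ℝ :=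
  p • (ContinuousLinearMap.mul ℝ ℝ).bilinearComp (.fst ℝ ℝ E') (.fst ℝ ℝ E')
    + k.bilinearComp (.snd ℝ ℝ E') (.snd ℝ ℝ E')

@[simp] theorem prodForm_apply (p : ℝ) (k : E' →L[ℝ] E' →L[ℝ] ℝ) (u v : ℝ × E') :
    prodForm p k u v = p * (u.1 * v.1) + k u.2 v.2 := by
  simp [prodForm]

theorem contDiffOn_prodForm [FiniteDimensional ℝ E'] {W : Type*} [NormedAddCommGroup W]
    [NormedSpace ℝ W] {V : Set W} {n : ℕ∞ω} {p : W → ℝ} {k : W → E' →L[ℝ] E' →L[ℝ] ℝ}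
    (hp : ContDiffOn ℝ n p V) (hk : ContDiffOn ℝ n k V) :
    ContDiffOn ℝ n (fun x => prodForm (p x) (k x)) V := by
  refine contDiffOn_clm_apply.2 fun u => contDiffOn_clm_apply.2 fun v => ?_
  simp only [prodForm_apply]
  exact (hp.mul contDiffOn_const).add ((hk.clm_apply contDiffOn_const).clm_apply contDiffOn_const)

end Base

/-! ### Koszul form and its contractions for a degenerate warped product -/

section WarpedPatch

variable {E' : Type*} [NormedAddCommGroup E'] [NormedSpace ℝ E'] [FiniteDimensional ℝ E']

/-- The metric `g` has the components `-c² dt² + a(t)² h` in the patch `J × U`. -/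
structure IsWarpedPatch (c : ℝ) (a : ℝ → ℝ) (J : Set ℝ) (U : Set E')
    (h : E' → E' →L[ℝ] E' →L[ℝ] ℝ) (g : ℝ × E' → LinearMap.BilinForm ℝ (ℝ × E')) : Prop where
  c_ne : c ≠ 0
  uniqueDiffOn : UniqueDiffOn ℝ J
  isOpen : IsOpen U
  contDiffOn_scale : ContDiffOn ℝ ∞ a J
  contDiffOn_base : ContDiffOn ℝ ∞ h U
  symm : ∀ y ∈ U, ∀ u v, h y u v = h y v u
  pos : ∀ y ∈ U, ∀ v, v ≠ 0 → 0 < h y v v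
  apply_eq : ∀ x ∈ J ×ˢ U, ∀ u v,
    g x u v = -c ^ 2 * (u.1 * v.1) + a x.1 ^ 2 * h x.2 u.2 v.2

/-- The coefficient of `-dt` in the Koszul form `𝒦(u, v, _)`, where `p` is the derivative of `v` in
the direction `u`. -/
def koszulTime (c : ℝ) (a : ℝ → ℝ) (J : Set ℝ) (h : E' → E' →L[ℝ] E' →L[ℝ] ℝ)
    (x u v p : ℝ × E') : ℝ :=
  a x.1 * derivWithin a J x.1 * h x.2 u.2 v.2 + c ^ 2 * p.1

/-- The vector representing the spatial part of the Koszul form `𝒦(u, v, _)`, divided by `a`. -/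
def koszulSpace (a : ℝ → ℝ) (J : Set ℝ) (h : E' → E' →L[ℝ] E' →L[ℝ] ℝ)
    (x u v p : ℝ × E') : E' :=
  derivWithin a J x.1 • (u.1 • v.2 + v.1 • u.2)
    + a x.1 • (christoffelVec (h x.2) (fderiv ℝ h x.2) u.2 v.2 + p.2)

namespace IsWarpedPatch

variable {c : ℝ} {a : ℝ → ℝ} {J : Set ℝ} {U : Set E'} {h : E' → E' →L[ℝ] E' →L[ℝ] ℝ}
  {g : ℝ × E' → LinearMap.BilinForm ℝ (ℝ × E')}

theorem uniqueDiffOn_prod (H : IsWarpedPatch c a J U h g) : UniqueDiffOn ℝ (J ×ˢ U) :=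
  H.uniqueDiffOn.prod H.isOpen.uniqueDiffOn

theorem contDiffOn_deriv (H : IsWarpedPatch c a J U h g) :
    ContDiffOn ℝ ∞ (derivWithin a J) J :=
  H.contDiffOn_scale.derivWithin H.uniqueDiffOn (by simp)

theorem contDiffOn_fderiv (H : IsWarpedPatch c a J U h g) : ContDiffOn ℝ ∞ (fderiv ℝ h) U :=
  H.contDiffOn_base.fderiv_of_isOpen H.isOpen (by simp)

theorem contDiffOn_fderiv_fderiv (H : IsWarpedPatch c a J U h g) :
    ContDiffOn ℝ ∞ (fderiv ℝ (fderiv ℝ h)) U :=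
  H.contDiffOn_fderiv.fderiv_of_isOpen H.isOpen (by simp)

theorem isInvertible (H : IsWarpedPatch c a J U h g) {y : E'} (hy : y ∈ U) :
    (h y).IsInvertible :=
  isInvertible_of_pos _ (H.pos y hy)

theorem contDiffOn_inverse (H : IsWarpedPatch c a J U h g) :
    ContDiffOn ℝ ∞ (fun y => (h y).inverse) U := fun y hy =>
  (H.isInvertible hy).contDiffAt_map_inverse.comp_contDiffWithinAt y (H.contDiffOn_base y hy)

theorem fderiv_symm (H : IsWarpedPatch c a J U h g) {y : E'} (hy : y ∈ U) (e u v : E') :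
    fderiv ℝ h y e u v = fderiv ℝ h y e v u := by
  have hd := ((H.contDiffOn_base.differentiableOn (by simp)).differentiableAt
    (H.isOpen.mem_nhds hy)).hasFDerivAt
  have h1 := (hd.clm_apply (hasFDerivAt_const u y)).clm_apply (hasFDerivAt_const v y)
  have h2 := (hd.clm_apply (hasFDerivAt_const v y)).clm_apply (hasFDerivAt_const u y)
  have h3 := h1.congr_of_eventuallyEq (f₁ := fun y => h y v u)
    (Filter.eventually_of_mem (H.isOpen.mem_nhds hy) fun z hz => H.symm z hz v u)
  simpa using congrArg (fun f => f e) (h3.unique h2)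

theorem apply_christoffelVec (H : IsWarpedPatch c a J U h g) {y : E'} (hy : y ∈ U) (u v : E') :
    h y (christoffelVec (h y) (fderiv ℝ h y) u v) = christoffelForm (fderiv ℝ h y) u v :=
  (H.isInvertible hy).self_apply_inverse _

variable {W : Set (ℝ × E')}

theorem hasFDerivWithinAt_comp_fst {f : ℝ → ℝ} (hf : ContDiffOn ℝ ∞ f J) (hW : W ⊆ J ×ˢ U)
    {x : ℝ × E'} (hx : x ∈ W) : HasFDerivWithinAt (fun q : ℝ × E' => f q.1)
      (derivWithin f J x.1 • ContinuousLinearMap.fst ℝ ℝ E') W x :=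
  ((hf.differentiableOn (by simp)) x.1 (hW hx).1).hasDerivWithinAt.comp_hasFDerivWithinAt x
    hasFDerivWithinAt_fst fun _ hq => (hW hq).1

theorem hasFDerivWithinAt_comp_snd {F : Type*} [NormedAddCommGroup F] [NormedSpace ℝ F]
    {f : E' → F} (hU : IsOpen U) (hf : ContDiffOn ℝ ∞ f U) (hW : W ⊆ J ×ˢ U)
    {x : ℝ × E'} (hx : x ∈ W) : HasFDerivWithinAt (fun q : ℝ × E' => f q.2)
      ((fderiv ℝ f x.2).comp (ContinuousLinearMap.snd ℝ ℝ E')) W x :=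
  ((hf.differentiableOn (by simp)).differentiableAt
    (hU.mem_nhds (hW hx).2)).hasFDerivAt.comp_hasFDerivWithinAt x hasFDerivWithinAt_snd

theorem contDiffOn_comp_fst {f : ℝ → ℝ} (hf : ContDiffOn ℝ ∞ f J) (hW : W ⊆ J ×ˢ U) :
    ContDiffOn ℝ ∞ (fun q : ℝ × E' => f q.1) W :=
  hf.comp contDiffOn_fst fun _ hq => (hW hq).1

theorem contDiffOn_comp_snd {F : Type*} [NormedAddCommGroup F] [NormedSpace ℝ F]
    {f : E' → F} (hf : ContDiffOn ℝ ∞ f U) (hW : W ⊆ J ×ˢ U) :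
    ContDiffOn ℝ ∞ (fun q : ℝ × E' => f q.2) W :=
  hf.comp contDiffOn_snd fun _ hq => (hW hq).2

theorem contDiffOn_metric (H : IsWarpedPatch c a J U h g) (hW : W ⊆ J ×ˢ U) :
    ContDiffOn ℝ ∞ (fun x => prodForm (-c ^ 2) (a x.1 ^ 2 • h x.2)) W :=
  contDiffOn_prodForm contDiffOn_const
    (((contDiffOn_comp_fst H.contDiffOn_scale hW).pow 2).smul
      (contDiffOn_comp_snd H.contDiffOn_base hW))

theorem fderivWithin_metric (H : IsWarpedPatch c a J U h g) (hW : W ⊆ J ×ˢ U) {x : ℝ × E'}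
    (hx : x ∈ W) (hu : UniqueDiffWithinAt ℝ W x) (e u v : ℝ × E') :
    fderivWithin ℝ (fun x => prodForm (-c ^ 2) (a x.1 ^ 2 • h x.2)) W x e u v =
      2 * a x.1 * derivWithin a J x.1 * e.1 * h x.2 u.2 v.2
        + a x.1 ^ 2 * fderiv ℝ h x.2 e.2 u.2 v.2 := by
  have h0 := ((H.contDiffOn_metric hW).differentiableOn (by simp) x hx).hasFDerivWithinAt
  have h1 := (h0.clm_apply (hasFDerivWithinAt_const u x W)).clm_apply
    (hasFDerivWithinAt_const v x W)
  have ha := hasFDerivWithinAt_comp_fst (E' := E') H.contDiffOn_scale hW hx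
  have hh := ((hasFDerivWithinAt_comp_snd H.isOpen H.contDiffOn_base hW hx).clm_apply
    (hasFDerivWithinAt_const u.2 x W)).clm_apply (hasFDerivWithinAt_const v.2 x W)
  have h2 := ((ha.pow 2).mul hh).const_add (-c ^ 2 * (u.1 * v.1))
  have h3 := h2.congr (f₁ := fun q => prodForm (-c ^ 2) (a q.1 ^ 2 • h q.2) u v)
    (fun q _ => by simp) (by simp)
  have := congrArg (fun f => f e) (hu.eq h1 h3)
  simp at this
  rw [this]
  ring

theorem apply_koszulSpace (H : IsWarpedPatch c a J U h g) {x : ℝ × E'} (hx : x.2 ∈ U)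
    (u v p : ℝ × E') (z : E') : h x.2 (koszulSpace a J h x u v p) z =
      derivWithin a J x.1 * (u.1 * h x.2 v.2 z + v.1 * h x.2 u.2 z)
        + a x.1 * (christoffelForm (fderiv ℝ h x.2) u.2 v.2 z + h x.2 p.2 z) := by
  have h1 := H.apply_christoffelVec hx u.2 v.2
  unfold koszulSpace
  generalize christoffelVec (h x.2) (fderiv ℝ h x.2) u.2 v.2 = w at *
  rw [← h1]
  simp only [map_add, map_smul, add_apply, smul_apply, smul_eq_mul]

/-- The Koszul form of a degenerate warped product. -/
theorem koszulForm_eq (H : IsWarpedPatch c a J U h g) (hW : W ⊆ J ×ˢ U) {x : ℝ × E'}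
    (hx : x ∈ W) (hu : UniqueDiffWithinAt ℝ W x) {X Y : ℝ × E' → ℝ × E'}
    (hX : DifferentiableWithinAt ℝ X W x) (hY : DifferentiableWithinAt ℝ Y W x) (z : ℝ × E') :
    koszulForm W g X Y x z =
      -(koszulTime c a J h x (X x) (Y x) (fderivWithin ℝ Y W x (X x)) * z.1)
        + a x.1 * h x.2 (koszulSpace a J h x (X x) (Y x) (fderivWithin ℝ Y W x (X x))) z.2 := by
  have hy := (hW hx).2
  have hG := ((H.contDiffOn_metric hW).differentiableOn (by simp) x hx).hasFDerivWithinAt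
  have key := koszulForm_eq_fderivWithin (g := g) (fun q hq u v => by
      rw [H.apply_eq q (hW hq), prodForm_apply, smul_apply, smul_apply, smul_eq_mul]) hx hu hG
    hX.hasFDerivWithinAt hY.hasFDerivWithinAt
    (fun u v => by
      simp only [prodForm_apply, smul_apply]
      rw [H.symm _ hy u.2, mul_comm u.1]) z
  rw [key]
  simp only [H.fderivWithin_metric hW hx hu, H.apply_koszulSpace hy, prodForm_apply, koszulTime,
    smul_apply, smul_eq_mul, christoffelForm_apply]
  rw [H.symm _ hy z.2]
  ring

theorem contDiffOn_koszulTime (H : IsWarpedPatch c a J U h g) (hW : W ⊆ J ×ˢ U)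
    {u v p : ℝ × E' → ℝ × E'} (hu : ContDiffOn ℝ ∞ u W) (hv : ContDiffOn ℝ ∞ v W)
    (hp : ContDiffOn ℝ ∞ p W) :
    ContDiffOn ℝ ∞ (fun x => koszulTime c a J h x (u x) (v x) (p x)) W :=
  (((contDiffOn_comp_fst H.contDiffOn_scale hW).mul
    (contDiffOn_comp_fst H.contDiffOn_deriv hW)).mul
    (((contDiffOn_comp_snd H.contDiffOn_base hW).clm_apply hu.snd).clm_apply hv.snd)).add
    (contDiffOn_const.mul hp.fst)

theorem contDiffOn_christoffelVec {Z : Type*} [NormedAddCommGroup Z] [NormedSpace ℝ Z] {W : Set Z}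
    (H : IsWarpedPatch c a J U h g) {y u v : Z → E'} (hy : ContDiffOn ℝ ∞ y W)
    (hyU : Set.MapsTo y W U) (hu : ContDiffOn ℝ ∞ u W) (hv : ContDiffOn ℝ ∞ v W) :
    ContDiffOn ℝ ∞ (fun x => christoffelVec (h (y x)) (fderiv ℝ h (y x)) (u x) (v x)) W := by
  refine (H.contDiffOn_inverse.comp hy hyU).clm_apply (contDiffOn_clm_apply.2 fun w => ?_)
  simp only [christoffelForm_apply]
  have hD : ContDiffOn ℝ ∞ (fun x => fderiv ℝ h (y x)) W := H.contDiffOn_fderiv.comp hy hyU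
  have hw : ContDiffOn ℝ ∞ (fun _ : Z => w) W := contDiffOn_const
  exact contDiffOn_const.mul ((((((hD.clm_apply hu).clm_apply hv).clm_apply hw)).add
    (((hD.clm_apply hv).clm_apply hw).clm_apply hu)).sub
    (((hD.clm_apply hw).clm_apply hu).clm_apply hv))

theorem contDiffOn_koszulSpace (H : IsWarpedPatch c a J U h g) (hW : W ⊆ J ×ˢ U)
    {u v p : ℝ × E' → ℝ × E'} (hu : ContDiffOn ℝ ∞ u W) (hv : ContDiffOn ℝ ∞ v W)
    (hp : ContDiffOn ℝ ∞ p W) :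
    ContDiffOn ℝ ∞ (fun x => koszulSpace a J h x (u x) (v x) (p x)) W :=
  ((contDiffOn_comp_fst H.contDiffOn_deriv hW).smul
    ((hu.fst.smul hv.snd).add (hv.fst.smul hu.snd))).add
    ((contDiffOn_comp_fst H.contDiffOn_scale hW).smul
      ((H.contDiffOn_christoffelVec contDiffOn_snd (fun _ hq => (hW hq).2) hu.snd hv.snd).add
        hp.snd))

/-- One formula for the representing vector serves at all points: where a = 0 the spatial part of
the form vanishes along with a, and the convention 0⁻¹ = 0 chooses the zero vector there. -/
theorem exists_apply_eq (H : IsWarpedPatch c a J U h g) {x : ℝ × E'} (hx : x ∈ J ×ˢ U) (p : ℝ)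
    (A : E') : ∀ z, g x (p / c ^ 2, (a x.1)⁻¹ • A) z = -(p * z.1) + a x.1 * h x.2 A z.2 := by
  intro z
  rw [H.apply_eq x hx]
  simp only [map_smul, smul_apply, smul_eq_mul]
  have := H.c_ne
  have h1 : a x.1 ^ 2 * ((a x.1)⁻¹ * h x.2 A z.2) = a x.1 * h x.2 A z.2 := by
    by_cases h0 : a x.1 = 0
    · simp [h0]
    · field_simp
  rw [h1]
  field_simp

/-- The factor a² of the spatial metric cancels the two factors a⁻¹ of the representing vectors, so
the value stays regular as a tends to 0. -/
theorem contract_eq (H : IsWarpedPatch c a J U h g) {x : ℝ × E'} (hx : x ∈ J ×ˢ U)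
    (hax : a x.1 ≠ 0) {α β : ℝ × E' → ℝ} {p q : ℝ} {A B : E'}
    (hα : ∀ z, α z = -(p * z.1) + a x.1 * h x.2 A z.2)
    (hβ : ∀ z, β z = -(q * z.1) + a x.1 * h x.2 B z.2) :
    contract (g x) α β = -(p * q / c ^ 2) + h x.2 A B := by
  rw [SingularGR.contract_eq (g x) (fun u v => by
      rw [H.apply_eq x hx, H.apply_eq x hx, H.symm _ hx.2 u.2, mul_comm u.1]) α β _ _
    (fun z => (H.exists_apply_eq hx p A z).trans (hα z).symm)
    (fun z => (H.exists_apply_eq hx q B z).trans (hβ z).symm), H.exists_apply_eq hx]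
  simp only [map_smul, smul_eq_mul]
  field_simp

/-- At a zero of a every spatial vector lies in the radical of the metric. -/
theorem scale_ne_zero [Nontrivial E'] (H : IsWarpedPatch c a J U h g) {x : ℝ × E'}
    (hx : x ∈ J ×ˢ U) (hg : (g x).Nondegenerate) : a x.1 ≠ 0 := by
  intro h0
  obtain ⟨v, hv⟩ := exists_ne (0 : E')
  have := hg.1 (0, v) fun w => by rw [H.apply_eq x hx]; simp [h0]
  exact hv (by simpa using congrArg Prod.snd this)

end IsWarpedPatch

end WarpedPatch

/-! ### Riemann curvature of the warped product -/

section WarpedPatch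

variable {E' : Type*} [NormedAddCommGroup E'] [NormedSpace ℝ E'] [FiniteDimensional ℝ E']

namespace IsWarpedPatch

variable {c : ℝ} {a : ℝ → ℝ} {J : Set ℝ} {U : Set E'} {h : E' → E' →L[ℝ] E' →L[ℝ] ℝ}
  {g : ℝ × E' → LinearMap.BilinForm ℝ (ℝ × E')}

theorem christoffel_eq_koszul (H : IsWarpedPatch c a J U h g) {x : ℝ × E'} (hx : x ∈ J ×ˢ U)
    (u v w : ℝ × E') : christoffel (J ×ˢ U) g u v w x =
      -(koszulTime c a J h x u v 0 * w.1) + a x.1 * h x.2 (koszulSpace a J h x u v 0) w.2 := by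
  have := H.koszulForm_eq subset_rfl hx (H.uniqueDiffOn_prod x hx)
    (differentiableWithinAt_const u) (differentiableWithinAt_const v) w
  rw [fderivWithin_const_apply, zero_apply] at this
  exact this

theorem christoffel_eq (H : IsWarpedPatch c a J U h g) {x : ℝ × E'} (hx : x ∈ J ×ˢ U)
    (u v w : ℝ × E') : christoffel (J ×ˢ U) g u v w x =
      a x.1 * derivWithin a J x.1 *
          (u.1 * h x.2 v.2 w.2 + v.1 * h x.2 u.2 w.2 - w.1 * h x.2 u.2 v.2)
        + a x.1 ^ 2 * christoffelForm (fderiv ℝ h x.2) u.2 v.2 w.2 := by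
  rw [H.christoffel_eq_koszul hx, H.apply_koszulSpace hx.2]
  simp only [koszulTime, Prod.fst_zero, Prod.snd_zero, map_zero, zero_apply]
  ring

theorem fderivWithin_christoffel (H : IsWarpedPatch c a J U h g) {x : ℝ × E'} (hx : x ∈ J ×ˢ U)
    (u v w e : ℝ × E') : fderivWithin ℝ (christoffel (J ×ˢ U) g u v w) (J ×ˢ U) x e =
      (derivWithin a J x.1 ^ 2 + a x.1 * derivWithin (derivWithin a J) J x.1) * e.1 *
          (u.1 * h x.2 v.2 w.2 + v.1 * h x.2 u.2 w.2 - w.1 * h x.2 u.2 v.2)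
        + a x.1 * derivWithin a J x.1 * (u.1 * fderiv ℝ h x.2 e.2 v.2 w.2
          + v.1 * fderiv ℝ h x.2 e.2 u.2 w.2 - w.1 * fderiv ℝ h x.2 e.2 u.2 v.2)
        + 2 * a x.1 * derivWithin a J x.1 * e.1 * christoffelForm (fderiv ℝ h x.2) u.2 v.2 w.2
        + a x.1 ^ 2 * christoffelForm (fderiv ℝ (fderiv ℝ h) x.2 e.2) u.2 v.2 w.2 := by
  have ha := hasFDerivWithinAt_comp_fst (E' := E') H.contDiffOn_scale subset_rfl hx
  have ha' := hasFDerivWithinAt_comp_fst (E' := E') H.contDiffOn_deriv subset_rfl hx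
  have hc : ∀ p : E', HasFDerivWithinAt (fun _ : ℝ × E' => p) (0 : ℝ × E' →L[ℝ] E') (J ×ˢ U) x :=
    fun p => hasFDerivWithinAt_const p x _
  have hh : ∀ p q : E', ∃ L, HasFDerivWithinAt (fun x : ℝ × E' => h x.2 p q) L (J ×ˢ U) x ∧
      L e = fderiv ℝ h x.2 e.2 p q := fun p q =>
    ⟨_, ((hasFDerivWithinAt_comp_snd H.isOpen H.contDiffOn_base subset_rfl hx).clm_apply
      (hc p)).clm_apply (hc q), by simp⟩
  have hD : ∀ p q r : E', ∃ L, HasFDerivWithinAt (fun x : ℝ × E' => fderiv ℝ h x.2 p q r) L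
      (J ×ˢ U) x ∧ L e = fderiv ℝ (fderiv ℝ h) x.2 e.2 p q r := fun p q r =>
    ⟨_, (((hasFDerivWithinAt_comp_snd H.isOpen H.contDiffOn_fderiv subset_rfl hx).clm_apply
      (hc p)).clm_apply (hc q)).clm_apply (hc r), by simp⟩
  obtain ⟨L₁, hL₁, e₁⟩ := hh v.2 w.2
  obtain ⟨L₂, hL₂, e₂⟩ := hh u.2 w.2
  obtain ⟨L₃, hL₃, e₃⟩ := hh u.2 v.2
  obtain ⟨M₁, hM₁, f₁⟩ := hD u.2 v.2 w.2
  obtain ⟨M₂, hM₂, f₂⟩ := hD v.2 w.2 u.2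
  obtain ⟨M₃, hM₃, f₃⟩ := hD w.2 u.2 v.2
  have key := ((ha.mul ha').mul (((hL₁.const_mul u.1).add (hL₂.const_mul v.1)).sub
    (hL₃.const_mul w.1))).add ((ha.pow 2).mul (((hM₁.add hM₂).sub hM₃).const_mul (1 / 2)))
  have key' := key.congr (f₁ := christoffel (J ×ˢ U) g u v w)
    (fun q hq => by rw [H.christoffel_eq hq, christoffelForm_apply]; rfl)
    (by rw [H.christoffel_eq hx, christoffelForm_apply]; rfl)
  rw [key'.fderivWithin (H.uniqueDiffOn_prod x hx)]
  simp only [christoffelForm_apply, add_apply, sub_apply, smul_apply, smul_eq_mul, e₁, e₂, e₃, f₁,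
    f₂, f₃, ContinuousLinearMap.coe_fst', Pi.mul_apply,
    Pi.add_apply, Pi.sub_apply, nsmul_eq_mul]
  push_cast
  ring

/-- The Riemann curvature of a degenerate warped product, where the metric is non-degenerate. -/
theorem riemann_eq (H : IsWarpedPatch c a J U h g) {x : ℝ × E'} (hx : x ∈ J ×ˢ U)
    (hax : a x.1 ≠ 0) (p q r s : ℝ × E') : riemann (J ×ˢ U) g x p q r s =
      a x.1 ^ 2 * curvatureForm (h x.2) (fderiv ℝ h x.2) (fderiv ℝ (fderiv ℝ h) x.2) p.2 q.2 r.2 s.2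
        - a x.1 ^ 2 * derivWithin a J x.1 ^ 2 / c ^ 2 *
          (h x.2 p.2 r.2 * h x.2 q.2 s.2 - h x.2 q.2 r.2 * h x.2 p.2 s.2)
        + a x.1 * derivWithin (derivWithin a J) J x.1 *
          (p.1 * r.1 * h x.2 q.2 s.2 - p.1 * s.1 * h x.2 q.2 r.2
            - q.1 * r.1 * h x.2 p.2 s.2 + q.1 * s.1 * h x.2 p.2 r.2) := by
  have hcon : ∀ u v u' v' : ℝ × E', contract (g x) (fun z => christoffel (J ×ˢ U) g u v z x)
      (fun z => christoffel (J ×ˢ U) g u' v' z x) =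
        -(a x.1 ^ 2 * derivWithin a J x.1 ^ 2 / c ^ 2 * (h x.2 u.2 v.2 * h x.2 u'.2 v'.2))
        + (derivWithin a J x.1 ^ 2 * (u.1 * (u'.1 * h x.2 v.2 v'.2 + v'.1 * h x.2 v.2 u'.2)
            + v.1 * (u'.1 * h x.2 u.2 v'.2 + v'.1 * h x.2 u.2 u'.2))
          + a x.1 * derivWithin a J x.1 *
            (u.1 * christoffelForm (fderiv ℝ h x.2) u'.2 v'.2 v.2
            + v.1 * christoffelForm (fderiv ℝ h x.2) u'.2 v'.2 u.2
            + u'.1 * christoffelForm (fderiv ℝ h x.2) u.2 v.2 v'.2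
            + v'.1 * christoffelForm (fderiv ℝ h x.2) u.2 v.2 u'.2)
          + a x.1 ^ 2 * h x.2 (christoffelVec (h x.2) (fderiv ℝ h x.2) u.2 v.2)
            (christoffelVec (h x.2) (fderiv ℝ h x.2) u'.2 v'.2)) := by
    intro u v u' v'
    have sy := H.symm _ hx.2
    have h₁ := H.apply_christoffelVec hx.2 u.2 v.2
    have h₂ := H.apply_christoffelVec hx.2 u'.2 v'.2
    -- The contraction contains h(A, A'). Since `apply_koszulSpace` expands only the first slot,
    -- symmetry moves A' there once A has been expanded.
    rw [H.contract_eq hx hax (fun z => H.christoffel_eq_koszul hx u v z)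
      (fun z => H.christoffel_eq_koszul hx u' v' z), H.apply_koszulSpace hx.2, ← h₁,
      sy v.2 (koszulSpace _ _ _ _ _ _ _), sy u.2 (koszulSpace _ _ _ _ _ _ _),
      sy (christoffelVec _ _ _ _) (koszulSpace _ _ _ _ _ _ _), H.apply_koszulSpace hx.2,
      H.apply_koszulSpace hx.2, H.apply_koszulSpace hx.2, ← h₂]
    generalize christoffelVec (h x.2) (fderiv ℝ h x.2) u.2 v.2 = w₁
    generalize christoffelVec (h x.2) (fderiv ℝ h x.2) u'.2 v'.2 = w₂
    simp only [koszulTime, Prod.fst_zero, Prod.snd_zero, map_zero, zero_apply]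
    linear_combination (a x.1 * derivWithin a J x.1 * u'.1) * sy v'.2 w₁
      + (a x.1 * derivWithin a J x.1 * v'.1) * sy u'.2 w₁
      + (derivWithin a J x.1 ^ 2 * u.1 * u'.1) * sy v'.2 v.2
      + (derivWithin a J x.1 ^ 2 * u.1 * v'.1) * sy u'.2 v.2
      + (derivWithin a J x.1 ^ 2 * v.1 * u'.1) * sy v'.2 u.2
      + (derivWithin a J x.1 ^ 2 * v.1 * v'.1) * sy u'.2 u.2 + a x.1 ^ 2 * sy w₂ w₁
  unfold riemann
  rw [hcon, hcon, H.fderivWithin_christoffel hx, H.fderivWithin_christoffel hx]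
  unfold curvatureForm
  simp only [christoffelForm_apply]
  have sy := H.symm _ hx.2
  have sD : ∀ e u v, fderiv ℝ h x.2 e u v = fderiv ℝ h x.2 e v u := H.fderiv_symm hx.2
  -- Once the arguments are in a fixed order, the terms in a a' and the mixed time-space terms in
  -- a'² coming from the derivatives cancel those coming from the contractions.
  simp only [sy q.2 p.2, sy r.2 p.2, sy r.2 q.2,
    fun e => sD e q.2 p.2, fun e => sD e r.2 p.2, fun e => sD e s.2 p.2, fun e => sD e r.2 q.2,
    fun e => sD e s.2 q.2, fun e => sD e s.2 r.2]
  ring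

end IsWarpedPatch

end WarpedPatch

/-! ### Ricci and scalar curvature of the warped product -/

section WarpedPatch

variable {E' : Type*} [NormedAddCommGroup E'] [NormedSpace ℝ E'] [FiniteDimensional ℝ E']

/-- The slots q, s are those contracted in the Ricci tensor: bilinearity here is what permits a
change of basis in the trace. The companion lemma for p, r makes the result a bilinear form. -/
theorem isBilinearMap_curvatureForm_inner (B : E' →L[ℝ] E' →L[ℝ] ℝ)
    (D : E' →L[ℝ] E' →L[ℝ] E' →L[ℝ] ℝ) (D₂ : E' →L[ℝ] E' →L[ℝ] E' →L[ℝ] E' →L[ℝ] ℝ) (p r : E') :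
    IsBilinearMap ℝ fun q s => curvatureForm B D D₂ p q r s where
  add_left q q' s := by
    simp only [curvatureForm, christoffelVec_add_left, christoffelForm_apply, map_add, add_apply]
    ring
  smul_left t q s := by
    simp only [curvatureForm, christoffelVec_smul_left, christoffelForm_apply, map_smul, smul_apply,
      smul_eq_mul]
    ring
  add_right q s s' := by
    simp only [curvatureForm, christoffelVec_add_right, map_add]
    ring
  smul_right t q s := by
    simp only [curvatureForm, christoffelVec_smul_right, map_smul, smul_eq_mul]
    ring

theorem isBilinearMap_curvatureForm_outer (B : E' →L[ℝ] E' →L[ℝ] ℝ)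
    (D : E' →L[ℝ] E' →L[ℝ] E' →L[ℝ] ℝ) (D₂ : E' →L[ℝ] E' →L[ℝ] E' →L[ℝ] E' →L[ℝ] ℝ) (q s : E') :
    IsBilinearMap ℝ fun p r => curvatureForm B D D₂ p q r s where
  add_left p p' r := by
    simp only [curvatureForm, christoffelVec_add_left, christoffelForm_apply, map_add, add_apply]
    ring
  smul_left t p r := by
    simp only [curvatureForm, christoffelVec_smul_left, christoffelForm_apply, map_smul, smul_apply,
      smul_eq_mul]
    ring
  add_right p r r' := by
    simp only [curvatureForm, christoffelVec_add_right, christoffelForm_add_right, map_add,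
      add_apply]
    ring
  smul_right t p r := by
    simp only [curvatureForm, christoffelVec_smul_right, christoffelForm_smul_right, map_smul,
      smul_apply, smul_eq_mul]
    ring

/-- The basis of `E'` that is dual to `Module.finBasis` with respect to the form `B`. -/
def dualVec (B : E' →L[ℝ] E' →L[ℝ] ℝ) (i : Fin (Module.finrank ℝ E')) : E' :=
  B.inverse ((Module.finBasis ℝ E').coord i).toContinuousLinearMap

/-- The spatial part of the Ricci curvature of a degenerate warped product. -/
def ricciSpace (c : ℝ) (a : ℝ → ℝ) (J : Set ℝ) (h : E' → E' →L[ℝ] E' →L[ℝ] ℝ) (x : ℝ × E')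
    (p q : E') : ℝ :=
  -(a x.1 * derivWithin (derivWithin a J) J x.1 / c ^ 2) * h x.2 p q
    + ∑ i, (curvatureForm (h x.2) (fderiv ℝ h x.2) (fderiv ℝ (fderiv ℝ h) x.2) p
        (dualVec (h x.2) i) q (Module.finBasis ℝ E' i)
      - derivWithin a J x.1 ^ 2 / c ^ 2 * (h x.2 p q
        - h x.2 (dualVec (h x.2) i) q * h x.2 p (Module.finBasis ℝ E' i)))

theorem isBilinearMap_ricciSpace (c : ℝ) (a : ℝ → ℝ) (J : Set ℝ)
    (h : E' → E' →L[ℝ] E' →L[ℝ] ℝ) (x : ℝ × E') : IsBilinearMap ℝ (ricciSpace c a J h x) where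
  add_left p p' r := by
    simp only [ricciSpace, (isBilinearMap_curvatureForm_outer _ _ _ _ _).add_left, map_add,
      add_apply]
    rw [add_add_add_comm, ← Finset.sum_add_distrib, ← mul_add]
    congr 1
    exact Finset.sum_congr rfl fun _ _ => by ring
  smul_left t p r := by
    simp only [ricciSpace, (isBilinearMap_curvatureForm_outer _ _ _ _ _).smul_left, map_smul,
      smul_apply, smul_eq_mul]
    rw [mul_add, Finset.mul_sum]
    congr 1
    · ring
    exact Finset.sum_congr rfl fun _ _ => by ring
  add_right p r r' := by
    simp only [ricciSpace, (isBilinearMap_curvatureForm_outer _ _ _ _ _).add_right, map_add]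
    rw [add_add_add_comm, ← Finset.sum_add_distrib, ← mul_add]
    congr 1
    exact Finset.sum_congr rfl fun _ _ => by ring
  smul_right t p r := by
    simp only [ricciSpace, (isBilinearMap_curvatureForm_outer _ _ _ _ _).smul_right, map_smul,
      smul_eq_mul]
    rw [mul_add, Finset.mul_sum]
    congr 1
    · ring
    exact Finset.sum_congr rfl fun _ _ => by ring

/-- `ricciSpace` as a continuous bilinear form. -/
def ricciSpaceForm (c : ℝ) (a : ℝ → ℝ) (J : Set ℝ) (h : E' → E' →L[ℝ] E' →L[ℝ] ℝ) (x : ℝ × E') :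
    E' →L[ℝ] E' →L[ℝ] ℝ :=
  (isBilinearMap_ricciSpace c a J h x).toContinuousBilinearMap

theorem ricciSpaceForm_apply (c : ℝ) (a : ℝ → ℝ) (J : Set ℝ) (h : E' → E' →L[ℝ] E' →L[ℝ] ℝ)
    (x : ℝ × E') (p q : E') : ricciSpaceForm c a J h x p q = ricciSpace c a J h x p q := rfl

/-- The scalar curvature of a degenerate warped product, multiplied by `a²`. -/
def scaledScalarCurv (c : ℝ) (a : ℝ → ℝ) (J : Set ℝ) (h : E' → E' →L[ℝ] E' →L[ℝ] ℝ)
    (x : ℝ × E') : ℝ :=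
  -(Module.finrank ℝ E' * (a x.1 * derivWithin (derivWithin a J) J x.1) / c ^ 2)
    + ∑ i, ricciSpaceForm c a J h x (dualVec (h x.2) i) (Module.finBasis ℝ E' i)

namespace IsWarpedPatch

variable {c : ℝ} {a : ℝ → ℝ} {J : Set ℝ} {U : Set E'} {h : E' → E' →L[ℝ] E' →L[ℝ] ℝ}
  {g : ℝ × E' → LinearMap.BilinForm ℝ (ℝ × E')}

theorem apply_dualVec (H : IsWarpedPatch c a J U h g) {y : E'} (hy : y ∈ U)
    (i : Fin (Module.finrank ℝ E')) (v : E') :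
    h y (dualVec (h y) i) v = (Module.finBasis ℝ E').coord i v := by
  rw [dualVec, (H.isInvertible hy).self_apply_inverse]
  rfl

/-- In a basis adapted to the splitting the dual vectors are explicit: -c⁻² times the time vector,
and a⁻² times the h-dual spatial vectors. -/
theorem metricTrace_eq (H : IsWarpedPatch c a J U h g) {x : ℝ × E'} (hx : x ∈ J ×ˢ U)
    (hax : a x.1 ≠ 0) (A : LinearMap.BilinForm ℝ (ℝ × E')) :
    metricTrace (g x) (fun s t => A s t) = -(c ^ 2)⁻¹ * A (1, 0) (1, 0)
      + (a x.1 ^ 2)⁻¹ * ∑ i, A (0, dualVec (h x.2) i) (0, Module.finBasis ℝ E' i) := by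
  have hc := H.c_ne
  rw [metricTrace_eq_sum (g x) A
    ((Module.Basis.singleton Unit ℝ).prod (Module.finBasis ℝ E'))
    (Sum.elim (fun _ => -(c ^ 2)⁻¹ • (1, 0)) fun i => (a x.1 ^ 2)⁻¹ • (0, dualVec (h x.2) i))]
  · rw [Fintype.sum_sum_type]
    simp only [Sum.elim_inl, Sum.elim_inr, map_smul, LinearMap.smul_apply, smul_eq_mul,
      Finset.mul_sum]
    simp
  · rintro (j | j) (i | i)
    · rw [H.apply_eq x hx]
      simp [hc]
    · rw [H.apply_eq x hx]
      simp
    · rw [H.apply_eq x hx]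
      simp
    · rw [H.apply_eq x hx]
      simp only [Module.Basis.prod_apply, Sum.elim_inr, LinearMap.coe_inr, Function.comp_apply,
        Prod.smul_snd, map_smul, smul_eq_mul, H.symm _ hx.2 _ (dualVec _ _),
        H.apply_dualVec hx.2]
      simp [Finsupp.single_apply, hax]

/-- The purely spatial curvature carries a², which cancels the a⁻² of the trace. The time-space part
carries only a a'': traced over space it leaves a''/a on dt², traced over time it stays regular. -/
theorem ricci_eq (H : IsWarpedPatch c a J U h g) {x : ℝ × E'} (hx : x ∈ J ×ˢ U)
    (hax : a x.1 ≠ 0) (p q : ℝ × E') : ricci (J ×ˢ U) g x p q =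
      prodForm (Module.finrank ℝ E' * (derivWithin (derivWithin a J) J x.1 / a x.1))
        (ricciSpaceForm c a J h x) p q := by
  have hb : IsBilinearMap ℝ fun s t => riemann (J ×ˢ U) g x p s q t := by
    have hK := isBilinearMap_curvatureForm_inner (h x.2) (fderiv ℝ h x.2)
      (fderiv ℝ (fderiv ℝ h) x.2) p.2 q.2
    simp only [H.riemann_eq hx hax]
    constructor
    · intro s s' t
      simp only [Prod.fst_add, Prod.snd_add, hK.add_left, map_add, add_apply]
      ring
    · intro r s t
      simp only [Prod.smul_fst, Prod.smul_snd, hK.smul_left, map_smul, smul_apply, smul_eq_mul]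
      ring
    · intro s t t'
      simp only [Prod.fst_add, Prod.snd_add, hK.add_right, map_add]
      ring
    · intro r s t
      simp only [Prod.smul_fst, Prod.smul_snd, hK.smul_right, map_smul, smul_eq_mul]
      ring
  -- The time vector of the trace has zero spatial part, so it contributes no curvature of the base.
  have h0 := (isBilinearMap_curvatureForm_inner (h x.2) (fderiv ℝ h x.2)
      (fderiv ℝ (fderiv ℝ h) x.2) p.2 q.2).smul_left 0 0 0
  simp only [zero_smul] at h0
  have := H.metricTrace_eq hx hax hb.toLinearMap
  refine Eq.trans this ?_
  change -(c ^ 2)⁻¹ * riemann (J ×ˢ U) g x p _ q _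
    + (a x.1 ^ 2)⁻¹ * ∑ i, riemann (J ×ˢ U) g x p _ q _ = _
  simp only [H.riemann_eq hx hax, h0, H.apply_dualVec hx.2, prodForm_apply, ricciSpaceForm_apply,
    ricciSpace, Module.Basis.coord_apply, Module.Basis.repr_self, Finsupp.single_eq_same,
    map_zero, zero_apply]
  -- Each spatial basis vector contributes one a''/a; writing the dimension as a sum lets the two
  -- sides be compared term by term.
  have hn : (Module.finrank ℝ E' : ℝ) = ∑ _i : Fin (Module.finrank ℝ E'), (1 : ℝ) := by simp
  rw [hn, Finset.sum_mul, Finset.sum_mul, Finset.mul_sum, add_left_comm, ← add_assoc,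
    add_assoc (-(a x.1 * derivWithin (derivWithin a J) J x.1 / c ^ 2) * _),
    ← Finset.sum_add_distrib]
  congr 1
  · ring
  · refine Finset.sum_congr rfl fun i _ => ?_
    field_simp
    ring

theorem scalarCurv_eq (H : IsWarpedPatch c a J U h g) {x : ℝ × E'} (hx : x ∈ J ×ˢ U)
    (hax : a x.1 ≠ 0) :
    scalarCurv (J ×ˢ U) g x = scaledScalarCurv c a J h x / a x.1 ^ 2 := by
  have h1 : ricci (J ×ˢ U) g x = fun s t =>
      (prodForm (Module.finrank ℝ E' * (derivWithin (derivWithin a J) J x.1 / a x.1))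
        (ricciSpaceForm c a J h x)).toLinearMap₁₂ s t :=
    funext fun s => funext fun t => H.ricci_eq hx hax s t
  have hc := H.c_ne
  have h2 : ∀ (L : ℝ × E' →L[ℝ] ℝ × E' →L[ℝ] ℝ) s t, L.toLinearMap₁₂ s t = L s t :=
    fun _ _ _ => rfl
  rw [scalarCurv, h1, H.metricTrace_eq hx hax]
  simp only [h2, prodForm_apply, scaledScalarCurv, map_zero,
    mul_zero, zero_add]
  field_simp
  ring

theorem contDiffOn_dualVec (H : IsWarpedPatch c a J U h g) (i : Fin (Module.finrank ℝ E')) :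
    ContDiffOn ℝ ∞ (fun y => dualVec (h y) i) U :=
  H.contDiffOn_inverse.clm_apply contDiffOn_const

theorem contDiffOn_curvatureForm (H : IsWarpedPatch c a J U h g) {p q r s : E' → E'}
    (hp : ContDiffOn ℝ ∞ p U) (hq : ContDiffOn ℝ ∞ q U) (hr : ContDiffOn ℝ ∞ r U)
    (hs : ContDiffOn ℝ ∞ s U) : ContDiffOn ℝ ∞ (fun y => curvatureForm (h y) (fderiv ℝ h y)
      (fderiv ℝ (fderiv ℝ h) y) (p y) (q y) (r y) (s y)) U := by
  have hG : ∀ {u v : E' → E'}, ContDiffOn ℝ ∞ u U → ContDiffOn ℝ ∞ v U →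
      ContDiffOn ℝ ∞ (fun y => christoffelVec (h y) (fderiv ℝ h y) (u y) (v y)) U := fun hu hv =>
    H.contDiffOn_christoffelVec contDiffOn_id (Set.mapsTo_id _) hu hv
  have hD : ∀ {e u v w : E' → E'}, ContDiffOn ℝ ∞ e U → ContDiffOn ℝ ∞ u U →
      ContDiffOn ℝ ∞ v U → ContDiffOn ℝ ∞ w U →
      ContDiffOn ℝ ∞ (fun y => fderiv ℝ (fderiv ℝ h) y (e y) (u y) (v y) (w y)) U :=
    fun he hu hv hw => (((H.contDiffOn_fderiv_fderiv.clm_apply he).clm_apply hu).clm_apply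
      hv).clm_apply hw
  have hC : ∀ {e u v w : E' → E'}, ContDiffOn ℝ ∞ e U → ContDiffOn ℝ ∞ u U →
      ContDiffOn ℝ ∞ v U → ContDiffOn ℝ ∞ w U → ContDiffOn ℝ ∞
        (fun y => christoffelForm (fderiv ℝ (fderiv ℝ h) y (e y)) (u y) (v y) (w y)) U := by
    intro e u v w he hu hv hw
    simp only [christoffelForm_apply]
    exact contDiffOn_const.mul (((hD he hu hv hw).add (hD he hv hw hu)).sub (hD he hw hu hv))
  have hB : ∀ {u v : E' → E'}, ContDiffOn ℝ ∞ u U → ContDiffOn ℝ ∞ v U →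
      ContDiffOn ℝ ∞ (fun y => h y (u y) (v y)) U := fun hu hv =>
    (H.contDiffOn_base.clm_apply hu).clm_apply hv
  exact (((hC hp hq hr hs).sub (hC hq hp hr hs)).add (hB (hG hp hr) (hG hq hs))).sub
    (hB (hG hq hr) (hG hp hs))

theorem contDiffOn_ricciSpaceForm (H : IsWarpedPatch c a J U h g) :
    ContDiffOn ℝ ∞ (ricciSpaceForm c a J h) (J ×ˢ U) := by
  refine contDiffOn_clm_apply.2 fun p => contDiffOn_clm_apply.2 fun q => ?_
  have ha := contDiffOn_comp_fst (E' := E') (U := U) H.contDiffOn_scale subset_rfl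
  have ha₁ := contDiffOn_comp_fst (E' := E') (U := U) H.contDiffOn_deriv subset_rfl
  have ha₂ := contDiffOn_comp_fst (E' := E') (U := U)
    (H.contDiffOn_deriv.derivWithin (m := ∞) H.uniqueDiffOn (by simp)) subset_rfl
  have hB : ∀ {u v : E' → E'}, ContDiffOn ℝ ∞ u U → ContDiffOn ℝ ∞ v U →
      ContDiffOn ℝ ∞ (fun x : ℝ × E' => h x.2 (u x.2) (v x.2)) (J ×ˢ U) := fun hu hv =>
    contDiffOn_comp_snd ((H.contDiffOn_base.clm_apply hu).clm_apply hv) subset_rfl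
  have hc : ∀ {v : E'}, ContDiffOn ℝ ∞ (fun _ : E' => v) U := contDiffOn_const
  exact (((ha.mul ha₂).div_const _).neg.mul (hB hc hc)).add (ContDiffOn.sum fun i _ =>
    (contDiffOn_comp_snd (H.contDiffOn_curvatureForm hc (H.contDiffOn_dualVec i) hc hc)
      subset_rfl).sub (((ha₁.pow 2).div_const _).mul ((hB hc hc).sub
        ((hB (H.contDiffOn_dualVec i) hc).mul (hB hc hc)))))

theorem contDiffOn_scaledScalarCurv (H : IsWarpedPatch c a J U h g) :
    ContDiffOn ℝ ∞ (scaledScalarCurv c a J h) (J ×ˢ U) := by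
  have ha := contDiffOn_comp_fst (E' := E') (U := U) H.contDiffOn_scale subset_rfl
  have ha₂ := contDiffOn_comp_fst (E' := E') (U := U)
    (H.contDiffOn_deriv.derivWithin (m := ∞) H.uniqueDiffOn (by simp)) subset_rfl
  exact (((contDiffOn_const.mul (ha.mul ha₂)).div_const _).neg).add (ContDiffOn.sum fun i _ =>
    (H.contDiffOn_ricciSpaceForm.clm_apply
      (contDiffOn_comp_snd (H.contDiffOn_dualVec i) subset_rfl)).clm_apply contDiffOn_const)

end IsWarpedPatch

end WarpedPatch

/-! ### Regularity of the warped product in a patch -/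

section WarpedPatch

variable {E' : Type*} [NormedAddCommGroup E'] [NormedSpace ℝ E'] [FiniteDimensional ℝ E']

namespace IsWarpedPatch

variable {c : ℝ} {a : ℝ → ℝ} {J : Set ℝ} {U : Set E'} {h : E' → E' →L[ℝ] E' →L[ℝ] ℝ}
  {g : ℝ × E' → LinearMap.BilinForm ℝ (ℝ × E')}

theorem contDiffOn_apply (H : IsWarpedPatch c a J U h g) (u v : ℝ × E') :
    ContDiffOn ℝ ∞ (fun x => g x u v) (J ×ˢ U) :=
  (((H.contDiffOn_metric subset_rfl).clm_apply (contDiffOn_const (c := u))).clm_apply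
    (contDiffOn_const (c := v))).congr fun x hx => by simp [H.apply_eq x hx]

theorem exists_koszulForm_eq (H : IsWarpedPatch c a J U h g) {O : Set (ℝ × E')} (hO : IsOpen O)
    {X Y : ℝ × E' → ℝ × E'} (hX : ContDiffOn ℝ ∞ X (J ×ˢ U ∩ O))
    (hY : ContDiffOn ℝ ∞ Y (J ×ˢ U ∩ O)) {x : ℝ × E'} (hx : x ∈ J ×ˢ U ∩ O) :
    ∃ v, ∀ z, g x v z = koszulForm (J ×ˢ U ∩ O) g X Y x z := by
  have hu := H.uniqueDiffOn_prod.inter hO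
  refine ⟨_, fun z => (H.exists_apply_eq hx.1 _ _ z).trans
    (H.koszulForm_eq Set.inter_subset_left hx (hu x hx) (hX.differentiableOn (by simp) x hx)
      (hY.differentiableOn (by simp) x hx) z).symm⟩

theorem exists_contDiffOn_contract (H : IsWarpedPatch c a J U h g) [Nontrivial E']
    {O : Set (ℝ × E')} (hO : IsOpen O) {X Y Z T : ℝ × E' → ℝ × E'}
    (hX : ContDiffOn ℝ ∞ X (J ×ˢ U ∩ O)) (hY : ContDiffOn ℝ ∞ Y (J ×ˢ U ∩ O))
    (hZ : ContDiffOn ℝ ∞ Z (J ×ˢ U ∩ O)) (hT : ContDiffOn ℝ ∞ T (J ×ˢ U ∩ O)) :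
    ∃ f : ℝ × E' → ℝ, ContDiffOn ℝ ∞ f (J ×ˢ U ∩ O) ∧
      ∀ x ∈ J ×ˢ U ∩ O, (g x).Nondegenerate →
        f x = contract (g x) (koszulForm (J ×ˢ U ∩ O) g X Y x)
          (koszulForm (J ×ˢ U ∩ O) g Z T x) := by
  have hu := H.uniqueDiffOn_prod.inter hO
  have hW : J ×ˢ U ∩ O ⊆ J ×ˢ U := Set.inter_subset_left
  have hXY := (hY.fderivWithin hu (m := ∞) (by simp)).clm_apply hX
  have hZT := (hT.fderivWithin hu (m := ∞) (by simp)).clm_apply hZ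
  refine ⟨_, (((H.contDiffOn_koszulTime hW hX hY hXY).mul
    (H.contDiffOn_koszulTime hW hZ hT hZT)).div_const (c ^ 2)).neg.add
    (((contDiffOn_comp_snd H.contDiffOn_base hW).clm_apply
      (H.contDiffOn_koszulSpace hW hX hY hXY)).clm_apply (H.contDiffOn_koszulSpace hW hZ hT hZT)),
    fun x hx hg => ?_⟩
  exact (H.contract_eq hx.1 (H.scale_ne_zero hx.1 hg)
    (fun z => H.koszulForm_eq hW hx (hu x hx) (hX.differentiableOn (by simp) x hx)
      (hY.differentiableOn (by simp) x hx) z)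
    (fun z => H.koszulForm_eq hW hx (hu x hx) (hZ.differentiableOn (by simp) x hx)
      (hT.differentiableOn (by simp) x hx) z)).symm

theorem extendsSmoothlyOn_metric (H : IsWarpedPatch c a J U h g) :
    ExtendsSmoothlyOn (J ×ˢ U) g fun x =>
      kulkarniNomizu (fun u v => g x u v) (fun u v => g x u v) :=
  (extendsSmoothlyOn_kulkarniNomizu (H.contDiffOn_metric subset_rfl)
    (H.contDiffOn_metric subset_rfl)).congr fun x hx _ p q r s => by
      simp only [kulkarniNomizu, H.apply_eq x hx, prodForm_apply, smul_apply, smul_eq_mul]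

theorem extendsSmoothlyOn_scalarCurv (H : IsWarpedPatch c a J U h g) [Nontrivial E'] :
    ExtendsSmoothlyOn (J ×ˢ U) g fun x p q r s => scalarCurv (J ×ˢ U) g x *
      kulkarniNomizu (fun u v => g x u v) (fun u v => g x u v) p q r s := by
  have ha := contDiffOn_comp_fst (E' := E') (U := U) H.contDiffOn_scale subset_rfl
  have hh := contDiffOn_comp_snd (J := J) H.contDiffOn_base subset_rfl
  -- With R = s/a² this is the factorization R g ∘ g = (s h) ∘ (-2c² dt² + a² h). The 2 collects
  -- both mixed terms of g ∘ g, and dt² ∘ dt² = 0 has dropped out.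
  refine (extendsSmoothlyOn_kulkarniNomizu
    (contDiffOn_prodForm (p := fun _ => 0) contDiffOn_const
      (H.contDiffOn_scaledScalarCurv.smul hh))
    (contDiffOn_prodForm (p := fun _ => -2 * c ^ 2) contDiffOn_const
      ((ha.pow 2).smul hh))).congr fun x hx hg p q r s => ?_
  have hax := H.scale_ne_zero hx hg
  simp only [kulkarniNomizu, H.apply_eq x hx, prodForm_apply, smul_apply, smul_eq_mul,
    H.scalarCurv_eq hx hax, Pi.smul_apply']
  field_simp
  ring

theorem extendsSmoothlyOn_ricci (H : IsWarpedPatch c a J U h g) [Nontrivial E'] :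
    ExtendsSmoothlyOn (J ×ˢ U) g fun x =>
      kulkarniNomizu (ricci (J ×ˢ U) g x) (fun u v => g x u v) := by
  have ha := contDiffOn_comp_fst (E' := E') (U := U) H.contDiffOn_scale subset_rfl
  have ha₂ := contDiffOn_comp_fst (E' := E') (U := U)
    (H.contDiffOn_deriv.derivWithin (m := ∞) H.uniqueDiffOn (by simp)) subset_rfl
  have hh := contDiffOn_comp_snd (J := J) H.contDiffOn_base subset_rfl
  -- The singular part of the Ricci tensor: m (a''/a) dt² ∘ g = dt² ∘ (m a a'' h), as dt² ∘ dt² = 0.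
  -- The regular part is treated in `h₂`.
  have h₁ := extendsSmoothlyOn_kulkarniNomizu (g := g)
    (contDiffOn_prodForm (E' := E') (V := J ×ˢ U) (n := ∞) (p := fun _ => 1) (k := fun _ => 0)
      contDiffOn_const contDiffOn_const)
    (contDiffOn_prodForm (p := fun _ => 0) contDiffOn_const
      (((ha.mul ha₂).const_smul (Module.finrank ℝ E' : ℝ)).smul hh))
  have h₂ := extendsSmoothlyOn_kulkarniNomizu (g := g)
    (contDiffOn_prodForm (p := fun _ => 0) contDiffOn_const H.contDiffOn_ricciSpaceForm)
    (H.contDiffOn_metric subset_rfl)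
  refine (h₁.linearCombination h₂ 1 1).congr fun x hx hg p q r s => ?_
  have hax := H.scale_ne_zero hx hg
  simp only [kulkarniNomizu, H.apply_eq x hx, prodForm_apply, smul_apply, smul_eq_mul,
    H.ricci_eq hx hax, zero_apply, Pi.smul_apply']
  field_simp
  ring

theorem extendsSmoothlyOn_of_combination (H : IsWarpedPatch c a J U h g) [Nontrivial E']
    {k : ℝ × E' → ℝ × E' → ℝ × E' → ℝ} (r₁ r₂ r₃ : ℝ)
    (hk : ∀ x ∈ J ×ˢ U, (g x).Nondegenerate → ∀ u v, k x u v =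
      r₁ * ricci (J ×ˢ U) g x u v + r₂ * scalarCurv (J ×ˢ U) g x * g x u v + r₃ * g x u v) :
    ExtendsSmoothlyOn (J ×ˢ U) g fun x => kulkarniNomizu (k x) (fun u v => g x u v) := by
  refine ((H.extendsSmoothlyOn_ricci.linearCombination H.extendsSmoothlyOn_scalarCurv r₁
    r₂).linearCombination H.extendsSmoothlyOn_metric 1 r₃).congr fun x hx hg p q r s => ?_
  simp only [kulkarniNomizu, hk x hx hg]
  ring

theorem extendsSmoothlyOn_scalarPart (H : IsWarpedPatch c a J U h g) [Nontrivial E'] :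
    ExtendsSmoothlyOn (J ×ˢ U) g (scalarPart (J ×ˢ U) g) :=
  -- The second coefficient is 0, so the combination is just a constant multiple.
  (H.extendsSmoothlyOn_scalarCurv.linearCombination H.extendsSmoothlyOn_scalarCurv
    (1 / (2 * (Module.finrank ℝ (ℝ × E') : ℝ) * ((Module.finrank ℝ (ℝ × E') : ℝ) - 1))) 0).congr
    fun x _ _ p q r s => by
      rw [scalarPart, zero_mul, add_zero, mul_assoc]

theorem extendsSmoothlyOn_semiTracelessPart (H : IsWarpedPatch c a J U h g) [Nontrivial E'] :
    ExtendsSmoothlyOn (J ×ˢ U) g (semiTracelessPart (J ×ˢ U) g) := by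
  have := H.extendsSmoothlyOn_of_combination (k := tracelessRicci (J ×ˢ U) g) 1
    (-(1 / (Module.finrank ℝ (ℝ × E') : ℝ))) 0 fun x _ _ u v => by
      rw [tracelessRicci]; ring
  refine (this.linearCombination this
    (1 / ((Module.finrank ℝ (ℝ × E') : ℝ) - 2)) 0).congr fun x _ _ p q r s => ?_
  rw [semiTracelessPart, zero_mul, add_zero]

theorem extendsSmoothlyOn_expandedEinstein (H : IsWarpedPatch c a J U h g) [Nontrivial E'] :
    ExtendsSmoothlyOn (J ×ˢ U) g (expandedEinstein (J ×ˢ U) g) :=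
  H.extendsSmoothlyOn_of_combination 1 (-(1 / 2)) 0 fun x _ _ u v => by
    rw [einstein]; ring

theorem extendsSmoothlyOn_stressEnergy (H : IsWarpedPatch c a J U h g) [Nontrivial E']
    {T : ℝ × E' → LinearMap.BilinForm ℝ (ℝ × E')} {Λ κ : ℝ} (hκ : κ ≠ 0)
    (hT : ∀ x ∈ J ×ˢ U, (g x).Nondegenerate → ∀ u v,
      einstein (J ×ˢ U) g x u v + Λ * g x u v = κ * T x u v) :
    ExtendsSmoothlyOn (J ×ˢ U) g fun x =>
      kulkarniNomizu (fun u v => T x u v) (fun u v => g x u v) :=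
  H.extendsSmoothlyOn_of_combination κ⁻¹ (-(κ⁻¹ / 2)) (κ⁻¹ * Λ) fun x hx hg u v => by
    have := hT x hx hg u v
    rw [einstein] at this
    field_simp
    linear_combination (-2) * this

end IsWarpedPatch

end WarpedPatch

/-! ### Symmetry, non-degeneracy and signature at a point -/

section LinearAlgebra

variable {E' : Type*} [NormedAddCommGroup E'] [NormedSpace ℝ E'] [FiniteDimensional ℝ E']
  {B : LinearMap.BilinForm ℝ (ℝ × E')} {k : LinearMap.BilinForm ℝ E'} {c r : ℝ}

theorem symm_of_apply_eq
    (hB : ∀ u v, B u v = -c ^ 2 * (u.1 * v.1) + r ^ 2 * k u.2 v.2)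
    (hs : ∀ u v, k u v = k v u) (u v : ℝ × E') : B u v = B v u := by
  rw [hB, hB, hs, mul_comm u.1]

theorem nondegenerate_of_apply_eq
    (hB : ∀ u v, B u v = -c ^ 2 * (u.1 * v.1) + r ^ 2 * k u.2 v.2)
    (hs : ∀ u v, k u v = k v u) (hk : ∀ v, v ≠ 0 → 0 < k v v) (hc : c ≠ 0) (hr : r ≠ 0) :
    B.Nondegenerate := by
  have hl : ∀ u, (∀ v, B u v = 0) → u = 0 := by
    intro u hu
    have h1 := hu (u.1, 0)
    have h2 := hu (0, u.2)
    rw [hB] at h1 h2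
    refine Prod.ext ?_ ?_
    · simpa [hc] using h1
    · by_contra h0
      simp [hr, (hk _ h0).ne'] at h2
  exact ⟨hl, fun u hu => hl u fun v => (symm_of_apply_eq hB hs u v).trans (hu v)⟩

/-- A positive definite subspace projects injectively to the spatial factor, because B ≤ 0 on the
kernel of that projection, the time axis. -/
theorem sigPos_le_of_apply_eq
    (hB : ∀ u v, B u v = -c ^ 2 * (u.1 * v.1) + r ^ 2 * k u.2 v.2) :
    sigPos (LinearMap.BilinMap.toQuadraticMap B) ≤ Module.finrank ℝ E' := by
  obtain ⟨V, hV, hpos⟩ :=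
    exists_finrank_eq_sigPos_and_posDef (LinearMap.BilinMap.toQuadraticMap B)
  rw [← hV]
  refine LinearMap.finrank_le_finrank_of_injective
    (f := (LinearMap.snd ℝ ℝ E').comp V.subtype) ((injective_iff_map_eq_zero _).2 fun v hv => ?_)
  by_contra h0
  have h1 : 0 < B v v := hpos v h0
  have h2 : (v : ℝ × E').2 = 0 := hv
  rw [hB, h2, map_zero, mul_zero, add_zero] at h1
  nlinarith [mul_nonneg (sq_nonneg c) (mul_self_nonneg (v : ℝ × E').1)]

/-- Dually, a negative definite subspace projects injectively to the time axis, because B ≥ 0 on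
spatial vectors. -/
theorem sigNeg_le_of_apply_eq
    (hB : ∀ u v, B u v = -c ^ 2 * (u.1 * v.1) + r ^ 2 * k u.2 v.2)
    (hk : ∀ v, v ≠ 0 → 0 < k v v) :
    sigNeg (LinearMap.BilinMap.toQuadraticMap B) ≤ 1 := by
  obtain ⟨V, hV, hneg⟩ :=
    exists_finrank_eq_sigNeg_and_negDef (LinearMap.BilinMap.toQuadraticMap B)
  rw [← hV, ← Module.finrank_self ℝ]
  refine LinearMap.finrank_le_finrank_of_injective
    (f := (LinearMap.fst ℝ ℝ E').comp V.subtype) ((injective_iff_map_eq_zero _).2 fun v hv => ?_)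
  by_contra h0
  have h1 : 0 < -B v v := hneg v h0
  have h2 : (v : ℝ × E').1 = 0 := hv
  have h3 : 0 ≤ k (v : ℝ × E').2 (v : ℝ × E').2 := by
    by_cases h4 : (v : ℝ × E').2 = 0
    · simp [h4]
    · exact (hk _ h4).le
  rw [hB, h2, mul_zero, mul_zero, zero_add] at h1
  linarith [mul_nonneg (sq_nonneg r) h3]

end LinearAlgebra

/-! ### FLRW metrics in product charts -/

section FLRW

variable {S : Type*} [TopologicalSpace S]
    [ChartedSpace (EuclideanSpace ℝ (Fin 3)) S] [IsManifold (𝓡 3) ∞ S]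

/-- The components of the Riemannian metric `h` in the chart `e`. -/
def chartMetric (h : Bundle.ContMDiffRiemannianMetric (𝓡 3) ∞ (EuclideanSpace ℝ (Fin 3))
      (fun x : S => TangentSpace (𝓡 3) x))
    (e : OpenPartialHomeomorph S (EuclideanSpace ℝ (Fin 3))) (y : EuclideanSpace ℝ (Fin 3)) :
    EuclideanSpace ℝ (Fin 3) →L[ℝ] EuclideanSpace ℝ (Fin 3) →L[ℝ] ℝ :=
  let d : EuclideanSpace ℝ (Fin 3) →ₗ[ℝ] TangentSpace (𝓡 3) (e.symm y) :=
    (mfderiv (𝓡 3) (𝓡 3) e.symm y).toLinearMap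
  ((h.inner (e.symm y)).toLinearMap₁₂.compl₁₂ d d).toContinuousBilinearMap

theorem chartMetric_apply (h : Bundle.ContMDiffRiemannianMetric (𝓡 3) ∞ (EuclideanSpace ℝ (Fin 3))
      (fun x : S => TangentSpace (𝓡 3) x))
    (e : OpenPartialHomeomorph S (EuclideanSpace ℝ (Fin 3))) (y u v : EuclideanSpace ℝ (Fin 3)) :
    chartMetric h e y u v = h.inner (e.symm y) (mfderiv (𝓡 3) (𝓡 3) e.symm y u)
      (mfderiv (𝓡 3) (𝓡 3) e.symm y v) := rfl

variable (h : Bundle.ContMDiffRiemannianMetric (𝓡 3) ∞ (EuclideanSpace ℝ (Fin 3))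
      (fun x : S => TangentSpace (𝓡 3) x))
  {e : OpenPartialHomeomorph S (EuclideanSpace ℝ (Fin 3))}

/-- The coordinate field is the tangent map of the inverse chart composed with a constant section.
-/
theorem contMDiffOn_mfderiv_symm (he : e ∈ atlas (EuclideanSpace ℝ (Fin 3)) S)
    (u : EuclideanSpace ℝ (Fin 3)) :
    ContMDiffOn (𝓡 3) (𝓡 3).tangent ∞
      (fun y => (⟨e.symm y, mfderiv (𝓡 3) (𝓡 3) e.symm y u⟩ : TangentBundle (𝓡 3) S))
      e.target := by
  have h1 := contMDiffOn_symm_of_mem_maximalAtlas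
    (IsManifold.subset_maximalAtlas (I := 𝓡 3) (n := ∞) he)
  have : IsManifold (𝓡 3) 1 S := IsManifold.of_le (n := ∞) (by simp)
  have h2 := h1.contMDiffOn_tangentMapWithin (m := ∞) (by simp) e.open_target.uniqueMDiffOn
  have h3 : ContMDiffOn (𝓡 3) (𝓡 3).tangent ∞
      (fun y => (⟨y, u⟩ : TangentBundle (𝓡 3) (EuclideanSpace ℝ (Fin 3)))) e.target :=
    contMDiffOn_vectorSpace_iff_contDiffOn.2 contDiffOn_const
  refine (h2.comp h3 fun y hy => hy).congr fun y hy => ?_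
  simp only [Function.comp_apply, tangentMapWithin,
    mfderivWithin_of_isOpen e.open_target hy]

theorem contDiffOn_chartMetric (he : e ∈ atlas (EuclideanSpace ℝ (Fin 3)) S) :
    ContDiffOn ℝ ∞ (chartMetric h e) e.target := by
  refine contDiffOn_clm_apply.2 fun u => contDiffOn_clm_apply.2 fun v => ?_
  simp only [chartMetric_apply]
  rw [← contMDiffOn_iff_contDiffOn]
  intro y hy
  have hu := contMDiffOn_mfderiv_symm he u y hy
  have hv := contMDiffOn_mfderiv_symm he v y hy
  have hb : ContMDiffWithinAt (𝓡 3) (𝓡 3) ∞ e.symm e.target y :=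
    contMDiffOn_symm_of_mem_maximalAtlas
      (IsManifold.subset_maximalAtlas (I := 𝓡 3) (n := ∞) he) y hy
  -- Evaluating a smooth metric on smooth vector fields gives a smooth map into the trivial line
  -- bundle, whose fibre component is the wanted function.
  have : ContMDiffWithinAt (𝓡 3) ((𝓡 3).prod 𝓘(ℝ)) ∞
      (fun m => Bundle.TotalSpace.mk' ℝ (E := Bundle.Trivial S ℝ) (e.symm m)
        (h.inner (e.symm m) (mfderiv (𝓡 3) (𝓡 3) e.symm m u) (mfderiv (𝓡 3) (𝓡 3) e.symm m v)))
      e.target y := by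
    apply ContMDiffWithinAt.clm_bundle_apply₂ (F₁ := EuclideanSpace ℝ (Fin 3))
      (F₂ := EuclideanSpace ℝ (Fin 3))
    · exact ContMDiffAt.comp_contMDiffWithinAt y h.contMDiff.contMDiffAt hb
    · exact hu
    · exact hv
  simp only [Bundle.contMDiffWithinAt_totalSpace] at this
  exact this.2

theorem injective_mfderiv_symm (he : e ∈ atlas (EuclideanSpace ℝ (Fin 3)) S)
    {y : EuclideanSpace ℝ (Fin 3)} (hy : y ∈ e.target) {v : EuclideanSpace ℝ (Fin 3)}
    (hv : mfderiv (𝓡 3) (𝓡 3) e.symm y v = 0) : v = 0 := by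
  have : IsManifold (𝓡 3) 1 S := IsManifold.of_le (n := ∞) (by simp)
  have h1 : mfderiv (𝓡 3) (𝓡 3) e (e.symm y) (mfderiv (𝓡 3) (𝓡 3) e.symm y v) = v :=
    congrArg (fun f => f v) ((mdifferentiable_of_mem_atlas (I := 𝓡 3) he).comp_symm_deriv hy)
  rw [hv, map_zero] at h1
  exact h1.symm

theorem inChart_flrwMetric (c : ℝ) (a : ℝ → ℝ)
    (he : e ∈ atlas (EuclideanSpace ℝ (Fin 3)) S) {x : ℝ × EuclideanSpace ℝ (Fin 3)}
    (hx : x.2 ∈ e.target) (u v : ℝ × EuclideanSpace ℝ (Fin 3)) :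
    inChart (𝓘(ℝ, ℝ).prod (𝓡 3)) ((OpenPartialHomeomorph.refl ℝ).prod e) (flrwMetric c a h) x u v
      = -c ^ 2 * (u.1 * v.1) + a x.1 ^ 2 * chartMetric h e x.2 u.2 v.2 := by
  have : IsManifold (𝓡 3) 1 S := IsManifold.of_le (n := ∞) (by simp)
  have hs : HasMFDerivAt 𝓘(ℝ, ℝ × EuclideanSpace ℝ (Fin 3)) (𝓡 3)
      (fun q : ℝ × EuclideanSpace ℝ (Fin 3) => e.symm q.2) x
      ((mfderiv (𝓡 3) (𝓡 3) e.symm x.2).comp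
        (ContinuousLinearMap.snd ℝ ℝ (EuclideanSpace ℝ (Fin 3)))) :=
    ((mdifferentiable_of_mem_atlas (I := 𝓡 3) he).mdifferentiableAt_symm hx).hasMFDerivAt.comp x
      hasFDerivAt_snd.hasMFDerivAt
  have hf : HasMFDerivAt 𝓘(ℝ, ℝ × EuclideanSpace ℝ (Fin 3)) 𝓘(ℝ, ℝ)
      (fun q : ℝ × EuclideanSpace ℝ (Fin 3) => q.1) x
      (ContinuousLinearMap.fst ℝ ℝ (EuclideanSpace ℝ (Fin 3))) :=
    hasFDerivAt_fst.hasMFDerivAt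
  -- The inverse chart is the identity in time and `e.symm` in space, so its derivative respects the
  -- splitting and the pullback has no mixed terms.
  have key : mfderiv 𝓘(ℝ, ℝ × EuclideanSpace ℝ (Fin 3)) (𝓘(ℝ, ℝ).prod (𝓡 3))
      ((((OpenPartialHomeomorph.refl ℝ).prod e).extend (𝓘(ℝ, ℝ).prod (𝓡 3))).symm) x =
      (ContinuousLinearMap.fst ℝ ℝ (EuclideanSpace ℝ (Fin 3))).prod
        ((mfderiv (𝓡 3) (𝓡 3) e.symm x.2).comp
          (ContinuousLinearMap.snd ℝ ℝ (EuclideanSpace ℝ (Fin 3)))) :=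
    (hf.prodMk hs).mfderiv
  unfold inChart
  rw [key]
  rfl

theorem patch_prod (J : Set ℝ) :
    patch (𝓘(ℝ, ℝ).prod (𝓡 3)) ((OpenPartialHomeomorph.refl ℝ).prod e)
      (J ×ˢ (Set.univ : Set S)) = J ×ˢ e.target := by
  ext x
  rw [patch, OpenPartialHomeomorph.extend_target]
  exact ⟨fun hx => ⟨hx.2.1, hx.1.1.2⟩, fun hx => ⟨⟨⟨trivial, hx.2⟩, x, rfl⟩, hx.1, trivial⟩⟩

theorem isWarpedPatch_flrwMetric {c : ℝ} (hc : 0 < c) {a : ℝ → ℝ} {J : Set ℝ}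
    (hJ : J.OrdConnected) (hJ' : (interior J).Nonempty) (ha : ContDiffOn ℝ ∞ a J)
    (he : e ∈ atlas (EuclideanSpace ℝ (Fin 3)) S) :
    IsWarpedPatch c a J e.target (chartMetric h e) (inChart (𝓘(ℝ, ℝ).prod (𝓡 3))
      ((OpenPartialHomeomorph.refl ℝ).prod e) (flrwMetric c a h)) where
  c_ne := hc.ne'
  uniqueDiffOn := uniqueDiffOn_convex hJ.convex hJ'
  isOpen := e.open_target
  contDiffOn_scale := ha
  contDiffOn_base := contDiffOn_chartMetric h he
  symm _ _ _ _ := h.symm _ _ _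
  pos _ hy _ hv := h.pos _ _ fun h0 => hv (injective_mfderiv_symm he hy h0)
  apply_eq _ hx u v := inChart_flrwMetric h c a he hx.2 u v

/-- The atlas of ℝ consists of the identity alone, so time is the same coordinate in every chart and
a keeps its form. -/
theorem exists_eq_prod_of_mem_atlas
    {φ : OpenPartialHomeomorph (ℝ × S) (ModelProd ℝ (EuclideanSpace ℝ (Fin 3)))}
    (hφ : φ ∈ atlas (ModelProd ℝ (EuclideanSpace ℝ (Fin 3))) (ℝ × S)) :
    ∃ e ∈ atlas (EuclideanSpace ℝ (Fin 3)) S, φ = (OpenPartialHomeomorph.refl ℝ).prod e := by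
  obtain ⟨e₁, he₁, e, he, rfl⟩ := hφ
  rw [chartedSpaceSelf_atlas] at he₁
  exact ⟨e, he, by rw [he₁]⟩

theorem symm_flrwMetric (c : ℝ) (a : ℝ → ℝ) (p : ℝ × S)
    (u v : TangentSpace (𝓘(ℝ, ℝ).prod (𝓡 3)) p) :
    flrwMetric c a h p u v = flrwMetric c a h p v u :=
  symm_of_apply_eq (k := (h.inner p.2).toLinearMap₁₂) (fun _ _ => rfl) (h.symm p.2) u v

theorem nondegenerate_flrwMetric {c : ℝ} (hc : c ≠ 0) {a : ℝ → ℝ} {p : ℝ × S}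
    (hp : a p.1 ≠ 0) : (flrwMetric c a h p).Nondegenerate :=
  nondegenerate_of_apply_eq (k := (h.inner p.2).toLinearMap₁₂) (fun _ _ => rfl) (h.symm p.2)
    (h.pos p.2) hc hp

theorem sigPos_flrwMetric_le (c : ℝ) (a : ℝ → ℝ) (p : ℝ × S) :
    sigPos (LinearMap.BilinMap.toQuadraticMap (flrwMetric c a h p)) ≤ 3 :=
  (sigPos_le_of_apply_eq (k := (h.inner p.2).toLinearMap₁₂) (B := flrwMetric c a h p)
    fun _ _ => rfl).trans_eq finrank_euclideanSpace_fin

theorem sigNeg_flrwMetric_le (c : ℝ) (a : ℝ → ℝ) (p : ℝ × S) :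
    sigNeg (LinearMap.BilinMap.toQuadraticMap (flrwMetric c a h p)) ≤ 1 :=
  sigNeg_le_of_apply_eq (k := (h.inner p.2).toLinearMap₁₂) (B := flrwMetric c a h p)
    (fun _ _ => rfl) (h.pos p.2)

end FLRW

end SingularGR

end

/-! ### Assembly of the corollary -/

theorem mainTheorem4 {S : Type*} [TopologicalSpace S]
    [ChartedSpace (EuclideanSpace ℝ (Fin 3)) S] [IsManifold (𝓡 3) ∞ S]
    (h : Bundle.ContMDiffRiemannianMetric (𝓡 3) ∞ (EuclideanSpace ℝ (Fin 3))
      (fun x : S => TangentSpace (𝓡 3) x))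
    (J : Set ℝ) (hJ : J.OrdConnected) (hJ' : (interior J).Nonempty)
    (c : ℝ) (hc : 0 < c) (a : ℝ → ℝ) (ha : ContDiffOn ℝ ∞ a J)
    (ha' : J ⊆ closure {t ∈ J | a t ≠ 0}) :
    SingularGR.IsQuasiRegularSpacetime (𝓘(ℝ, ℝ).prod (𝓡 3)) (J ×ˢ (Set.univ : Set S))
        (SingularGR.flrwMetric c a h) ∧
      SingularGR.TensorExtendsSmoothly (𝓘(ℝ, ℝ).prod (𝓡 3)) (J ×ˢ (Set.univ : Set S))
        (SingularGR.flrwMetric c a h) (fun φ =>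
          SingularGR.expandedEinstein
            (SingularGR.patch (𝓘(ℝ, ℝ).prod (𝓡 3)) φ (J ×ˢ (Set.univ : Set S)))
            (SingularGR.inChart (𝓘(ℝ, ℝ).prod (𝓡 3)) φ (SingularGR.flrwMetric c a h))) ∧
      ∀ (Λ κ : ℝ), κ ≠ 0 → ∀ T : SingularGR.BilinField (𝓘(ℝ, ℝ).prod (𝓡 3)) (ℝ × S),
        SingularGR.EinsteinEquation (𝓘(ℝ, ℝ).prod (𝓡 3)) (J ×ˢ (Set.univ : Set S))
          (SingularGR.flrwMetric c a h) T Λ κ →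
        SingularGR.TensorExtendsSmoothly (𝓘(ℝ, ℝ).prod (𝓡 3)) (J ×ˢ (Set.univ : Set S))
          (SingularGR.flrwMetric c a h) (fun φ x =>
            SingularGR.kulkarniNomizu
              (fun u v => SingularGR.inChart (𝓘(ℝ, ℝ).prod (𝓡 3)) φ T x u v)
              (fun u v => SingularGR.inChart (𝓘(ℝ, ℝ).prod (𝓡 3)) φ
                (SingularGR.flrwMetric c a h) x u v)) := by
  -- Every chart sees a warped patch, so each chartwise condition below reduces to the corresponding
  -- statement for `IsWarpedPatch`.
  have hpatch : ∀ φ ∈ atlas (ModelProd ℝ (EuclideanSpace ℝ (Fin 3))) (ℝ × S), ∃ (U : Set _)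
      (k : _ → _), SingularGR.patch (𝓘(ℝ, ℝ).prod (𝓡 3)) φ (J ×ˢ (Set.univ : Set S)) = J ×ˢ U ∧
        SingularGR.IsWarpedPatch c a J U k
          (SingularGR.inChart (𝓘(ℝ, ℝ).prod (𝓡 3)) φ (SingularGR.flrwMetric c a h)) := by
    intro φ hφ
    obtain ⟨e, he, rfl⟩ := SingularGR.exists_eq_prod_of_mem_atlas hφ
    exact ⟨_, _, SingularGR.patch_prod J, SingularGR.isWarpedPatch_flrwMetric h hc hJ hJ' ha he⟩
  refine ⟨{ symm := ?_, smooth := ?_, dense := ?_, koszul_mem := ?_, koszul_contract := ?_,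
            scalarPart_extends := ?_, semiTracelessPart_extends := ?_, dim_eq := ?_,
            sigPos_le := ?_, sigNeg_le := ?_ }, ?_, ?_⟩
  · exact fun p _ u v => SingularGR.symm_flrwMetric h c a p u v
  · intro φ hφ u v
    obtain ⟨U, k, hU, H⟩ := hpatch φ hφ
    rw [hU]
    exact H.contDiffOn_apply u v
  · rintro ⟨t, p⟩ ⟨ht, -⟩
    have h1 : (t, p) ∈ closure ({t ∈ J | a t ≠ 0} ×ˢ (Set.univ : Set S)) := by
      rw [closure_prod_eq, closure_univ]
      exact ⟨ha' ht, trivial⟩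
    refine closure_mono ?_ h1
    rintro q ⟨⟨hq, hq'⟩, -⟩
    exact ⟨⟨hq, trivial⟩, SingularGR.nondegenerate_flrwMetric h hc.ne' hq'⟩
  · intro φ hφ O hO X Y hX hY x hx
    obtain ⟨U, k, hU, H⟩ := hpatch φ hφ
    rw [hU] at hX hY hx ⊢
    exact H.exists_koszulForm_eq hO hX hY hx
  · intro φ hφ O hO X Y Z T hX hY hZ hT
    obtain ⟨U, k, hU, H⟩ := hpatch φ hφ
    rw [hU] at hX hY hZ hT ⊢
    exact H.exists_contDiffOn_contract hO hX hY hZ hT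
  · intro φ hφ
    obtain ⟨U, k, hU, H⟩ := hpatch φ hφ
    beta_reduce
    rw [hU]
    exact H.extendsSmoothlyOn_scalarPart
  · intro φ hφ
    obtain ⟨U, k, hU, H⟩ := hpatch φ hφ
    beta_reduce
    rw [hU]
    exact H.extendsSmoothlyOn_semiTracelessPart
  · simp
  · exact fun p _ => SingularGR.sigPos_flrwMetric_le h c a p
  · exact fun p _ => SingularGR.sigNeg_flrwMetric_le h c a p
  · intro φ hφ
    obtain ⟨U, k, hU, H⟩ := hpatch φ hφ
    beta_reduce
    rw [hU]
    exact H.extendsSmoothlyOn_expandedEinstein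
  · intro Λ κ hκ T hT φ hφ
    obtain ⟨U, k, hU, H⟩ := hpatch φ hφ
    have hT' := hT φ hφ
    beta_reduce
    rw [hU] at hT' ⊢
    exact H.extendsSmoothlyOn_stressEnergy hκ hT'
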